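/- Let $b\ge 2$ be an integer. For $x\in[0,1)$ consider the base $b$ expansion $x=\sum_{j\ge1}x_jb^{-j}$ with $x_j\in\{0,\dots,b-1\}$ and $x_j\ne0$ for infinitely many $j$; for a general real number $x$ use the expansion of its fractional part. Write $x\restriction n$ for the word $x_1x_2\cdots x_{\lfloor n\rfloor}$. Integers have no such expansion and belong to neither of the sets below. Let $\mathcal N_b$ be the set of numbers $x$ that are Borel normal in base $b$, that is, for every word $w$ over $\{0,\dots,b-1\}$ of length $|w|$, $$\lim_{n\to\infty}\frac{\text{number of occurrences of } w \text{ in } x\restriction n}{n}=b^{-|w|}.$$ Let $\mathcal P_b$ be the set of numbers $x$ that are Poisson generic in base $b$, that is, for every real $\lambda>0$ and every integer $j\ge0$, $$\lim_{k\to\infty}\frac1{b^k}\Big|\big\{w\in\{0,\dots,b-1\}^k:\ w\text{ occurs exactly } j\text{ times in } x\restriction(\lambda b^k+k)\big\}\Big|=e^{-\lambda}\frac{\lambda^j}{j!}.$$ In a topological space, a set is $\boldsymbol\Sigma^0_1$ if it is open and $\boldsymbol\Pi^0_1$ if it is closed; it is $\boldsymbol\Sigma^0_{n+1}$ if it is a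 countable union of $\boldsymbol\Pi^0_n$ sets, and $\boldsymbol\Pi^0_{n+1}$ if it is a countable intersection of $\boldsymbol\Sigma^0_n$ sets. A set is $D_2\text{-}\boldsymbol\Pi^0_3$ if it is the difference $B\setminus C$ of two $\boldsymbol\Pi^0_3$ sets. A subset $A$ of a space $Y$ is $D_2\text{-}\boldsymbol\Pi^0_3$-complete if it is $D_2\text{-}\boldsymbol\Pi^0_3$ in $Y$ and, for every zero-dimensional Polish space $X$ and every $D_2\text{-}\boldsymbol\Pi^0_3$ set $B\subseteq X$, there is a continuous map $f\colon X\to Y$ with $f^{-1}(A)=B$. **Theorem.** The set $\mathcal N_b\setminus\mathcal P_b$ of numbers that are Borel normal but not Poisson generic in base $b$ is $D_2\text{-}\boldsymbol\Pi^0_3$-complete, both as a subset of $[0,1)$ (considering only the numbers in $[0,1)$) and as a subset of $\mathbb R$. -/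

import Mathlib

open Filter Topology

/-! ### Digit sequences, normality and Poisson genericity -/

/-- The number of occurrences of the word `w` of length `k` in the initial segment of length `N`
of the sequence `d`: the number of (0-based) starting positions `i` with `i + k ≤ N` at which
`w` can be read in `d`. -/
def occurrences {b : ℕ} (d : ℕ → Fin b) {k : ℕ} (w : Fin k → Fin b) (N : ℕ) : ℕ :=
  ((Finset.range (N + 1)).filter fun i => i + k ≤ N ∧ ∀ t : Fin k, d (i + t) = w t).card

/-- The sequence `d` (whose entry `d j` is the digit number `j + 1` after the point) is the base
`b` expansion of the fractional part of `x` that has infinitely many nonzero digits.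
It is unique if it exists, and it exists unless `x` is an integer. -/
def IsExpansion (b : ℕ) (x : ℝ) (d : ℕ → Fin b) : Prop :=
  Real.ofDigits d = Int.fract x ∧ ∃ᶠ j in atTop, (d j : ℕ) ≠ 0

/-- Every word `w` has asymptotic frequency `b ^ (-|w|)` in `d`. -/
def IsNormalSeq {b : ℕ} (d : ℕ → Fin b) : Prop :=
  ∀ (k : ℕ) (w : Fin k → Fin b),
    Tendsto (fun n : ℕ => (occurrences d w n : ℝ) / (n : ℝ)) atTop (𝓝 (1 / (b : ℝ) ^ k))

/-- `Z^l_{j,k}`: the proportion of words of length `k` that occur exactly `j` times in the initial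
segment of length `⌊l b ^ k + k⌋` of `d`. -/
noncomputable def poissonCount {b : ℕ} (l : ℝ) (j k : ℕ) (d : ℕ → Fin b) : ℝ :=
  1 / (b : ℝ) ^ k *
    ((Finset.univ.filter fun w : Fin k → Fin b =>
      occurrences d w ⌊l * (b : ℝ) ^ k + (k : ℝ)⌋₊ = j).card : ℝ)

/-- For every `l > 0`, the distribution of the number of occurrences of words of length `k` tends
pointwise to the Poisson distribution with parameter `l`, as `k → ∞`. -/
def IsPoissonGenericSeq {b : ℕ} (d : ℕ → Fin b) : Prop :=
  ∀ l : ℝ, 0 < l → ∀ j : ℕ,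
    Tendsto (fun k : ℕ => poissonCount l j k d) atTop
      (𝓝 (Real.exp (-l) * l ^ j / (j.factorial : ℝ)))

/-- The set of real numbers that are Borel normal in base `b`. -/
def normalNumbers (b : ℕ) : Set ℝ :=
  {x | ∃ d : ℕ → Fin b, IsExpansion b x d ∧ IsNormalSeq d}

/-- The set of real numbers that are Poisson generic in base `b`. -/
def poissonGenericNumbers (b : ℕ) : Set ℝ :=
  {x | ∃ d : ℕ → Fin b, IsExpansion b x d ∧ IsPoissonGenericSeq d}

/-! ### Finite levels of the Borel hierarchy, differences, completeness -/

mutual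
  /-- Boldface `Σ⁰ₙ` sets, for `n ≥ 1` (there are none for the unused index `0`). -/
  def IsSigma0 {X : Type*} [TopologicalSpace X] : ℕ → Set X → Prop
    | 0, _ => False
    | 1, A => IsOpen A
    | n + 2, A => ∃ F : ℕ → Set X, (∀ i, IsPi0 (n + 1) (F i)) ∧ A = ⋃ i, F i
  /-- Boldface `Π⁰ₙ` sets, for `n ≥ 1` (there are none for the unused index `0`). -/
  def IsPi0 {X : Type*} [TopologicalSpace X] : ℕ → Set X → Prop
    | 0, _ => False
    | 1, A => IsClosed A
    | n + 2, A => ∃ F : ℕ → Set X, (∀ i, IsSigma0 (n + 1) (F i)) ∧ A = ⋂ i, F i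
end

/-- The class `D₂-Π⁰₃` of differences of two boldface `Π⁰₃` sets. -/
def IsD2Pi03 {X : Type*} [TopologicalSpace X] (A : Set X) : Prop :=
  ∃ B C : Set X, IsPi0 3 B ∧ IsPi0 3 C ∧ A = B \ C

/-- `A` is hard for `D₂-Π⁰₃`: every `D₂-Π⁰₃` subset of a zero-dimensional Polish space (one with a
basis of clopen sets) is the preimage of `A` under a continuous map. -/
def IsD2Pi03Hard.{u, v} {Y : Type v} [TopologicalSpace Y] (A : Set Y) : Prop :=
  ∀ (X : Type u) [TopologicalSpace X] [PolishSpace X],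
    TopologicalSpace.IsTopologicalBasis {s : Set X | IsClopen s} →
    ∀ B : Set X, IsD2Pi03 B → ∃ f : X → Y, Continuous f ∧ f ⁻¹' A = B

/-- `A` is complete for `D₂-Π⁰₃`: it belongs to the class and is hard for it. -/
def IsD2Pi03Complete.{u, v} {Y : Type v} [TopologicalSpace Y] (A : Set Y) : Prop :=
  IsD2Pi03 A ∧ IsD2Pi03Hard.{u, v} A

universe u

/-! ### Borel classes -/

section BorelClasses

variable {X Y : Type*} [TopologicalSpace X] [TopologicalSpace Y]

-- Upper bound. Normality and Poisson genericity of a digit sequence are conjunctions of limits of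
-- quantities that depend on finitely many digits, hence `Π⁰₃` once the conjunctions are countable;
-- for the Poisson condition, rational parameters suffice (`isPoissonGenericSeq_of_rat`). The digits
-- of a real number are continuous off the countable set of terminating numbers, none of which is
-- normal, so the bound passes to `ℝ` (`isD2Pi03_normal_diff_poissonGeneric`).
--
-- Hardness. In a zero-dimensional space a `Π⁰₃` set is `{x | g x → ∞}` for some `g` with locally
-- constant coordinates (`IsPi0.three_exists_tendsto_atTop`). A difference `C \ D` thus gives two
-- such functions `g`, `h`, which `splice` codes into one sequence. Let `y` be normal and Poisson
-- generic. At each of a sparse set of scales `N = b ^ k`, the last `N / (h + 2)` digits before `N`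
-- are overwritten by a copy of the beginning of `y`, and about `N / (g + 2)` digits from `N` on by
-- a one and zeros. The zeros leave normality intact exactly when `g → ∞`. The copies never harm it,
-- since a copied piece of `y` has the right frequencies. They do harm Poisson genericity when `h`
-- does not tend to infinity: at infinitely many scales a fixed fraction of the first `N` windows of
-- length `k` repeats earlier ones, so the proportion of missing words stays near or above `exp
-- (-l)` with `l < 1` instead of tending to `exp (-1)`. If `g` and `h` both tend to infinity, the
-- changes are negligible and `y` passes on its Poisson genericity.
--
-- Existence of `y`. Uniform random digits have both properties almost surely, by second moments.
-- For words of length `k`, the mean square error of the proportion of words seen `j` times obeys a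
-- discrete form of the Poisson equations `p_j' = p_(j-1) - p_j` (`poissonVariance_le`), with errors
-- summable in `k`.

theorem isSigma0_two_iff {A : Set X} :
    IsSigma0 2 A ↔ ∃ F : ℕ → Set X, (∀ i, IsClosed (F i)) ∧ A = ⋃ i, F i :=
  Iff.rfl

theorem isPi0_three_iff {A : Set X} :
    IsPi0 3 A ↔ ∃ F : ℕ → Set X, (∀ i, IsSigma0 2 (F i)) ∧ A = ⋂ i, F i :=
  Iff.rfl

theorem IsPi0.three_iInter {ι : Type*} [Countable ι] [Nonempty ι] {A : ι → Set X}
    (h : ∀ i, IsPi0 3 (A i)) : IsPi0 3 (⋂ i, A i) := by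
  choose F hF hA using h
  obtain ⟨e, he⟩ := exists_surjective_nat ι
  refine isPi0_three_iff.2 ⟨fun n => F (e n.unpair.1) n.unpair.2, fun n => hF _ _, ?_⟩
  ext x
  simp only [hA, Set.mem_iInter]
  refine ⟨fun H n => H _ _, fun H i j => ?_⟩
  obtain ⟨m, rfl⟩ := he i
  simpa using H (Nat.pair m j)

theorem IsSigma0.isPi0_three {A : Set X} (h : IsSigma0 2 A) : IsPi0 3 A :=
  isPi0_three_iff.2 ⟨fun _ => A, fun _ => h, (Set.iInter_const A).symm⟩

theorem IsSigma0.two_eventually {Q : ℕ → Set X} (h : ∀ k, IsClosed (Q k)) :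
    IsSigma0 2 {x | ∀ᶠ k in atTop, x ∈ Q k} := by
  refine isSigma0_two_iff.2 ⟨fun m => ⋂ k, ⋂ (_ : m ≤ k), Q k,
    fun m => isClosed_iInter fun k => isClosed_iInter fun _ => h k, ?_⟩
  ext x
  simp [eventually_atTop]

theorem IsPi0.three_preimage {A : Set Y} (h : IsPi0 3 A) {f : X → Y} (hf : Continuous f) :
    IsPi0 3 (f ⁻¹' A) := by
  obtain ⟨F, hF, rfl⟩ := isPi0_three_iff.1 h
  refine isPi0_three_iff.2 ⟨fun i => f ⁻¹' F i, fun i => ?_, Set.preimage_iInter⟩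
  obtain ⟨G, hG, hFG⟩ := isSigma0_two_iff.1 (hF i)
  exact isSigma0_two_iff.2 ⟨fun j => f ⁻¹' G j, fun j => (hG j).preimage hf,
    by simp only [hFG, Set.preimage_iUnion]⟩

theorem IsD2Pi03.preimage {A : Set Y} (h : IsD2Pi03 A) {f : X → Y} (hf : Continuous f) :
    IsD2Pi03 (f ⁻¹' A) := by
  obtain ⟨B, C, hB, hC, rfl⟩ := h
  exact ⟨_, _, hB.three_preimage hf, hC.three_preimage hf, rfl⟩

theorem IsOpen.isSigma0_two {Z : Type*} [PseudoMetricSpace Z] {A : Set Z} (h : IsOpen A) :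
    IsSigma0 2 A := by
  obtain ⟨F, hF, -, hA, -⟩ := h.exists_iUnion_isClosed
  exact isSigma0_two_iff.2 ⟨F, hF, hA.symm⟩

theorem IsGδ.isPi0_three {Z : Type*} [PseudoMetricSpace Z] {A : Set Z} (h : IsGδ A) :
    IsPi0 3 A := by
  obtain ⟨F, hF, rfl⟩ := isGδ_iff_eq_iInter_nat.1 h
  exact IsPi0.three_iInter fun i => (hF i).isSigma0_two.isPi0_three

/-- Relatively closed sets extend to closed sets of the ambient space. Applying the same set
operations to the extensions and cutting with `U` once recovers the image, and `U` is itself `Π⁰₃`.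
-/
theorem IsPi0.three_image_val {Z : Type*} [PseudoMetricSpace Z] {U : Set Z} (hU : IsGδ U)
    {A : Set U} (hA : IsPi0 3 A) : IsPi0 3 (Subtype.val '' A) := by
  obtain ⟨F, hF, rfl⟩ := isPi0_three_iff.1 hA
  choose G hG hFG using fun i => isSigma0_two_iff.1 (hF i)
  choose H hH hGH using fun i j => isClosed_induced_iff.1 (hG i j)
  have : Subtype.val '' (⋂ i, F i) = ⋂ o : Option ℕ, o.elim U fun i => ⋃ j, H i j := by
    ext x
    simp only [Set.mem_image, Set.mem_iInter, hFG, Set.mem_iUnion, ← hGH, Set.mem_preimage,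
      Option.forall, Option.elim]
    constructor
    · rintro ⟨y, hy, rfl⟩
      exact ⟨y.2, hy⟩
    · rintro ⟨hx, hy⟩
      exact ⟨⟨x, hx⟩, hy, rfl⟩
  rw [this]
  refine IsPi0.three_iInter fun o => ?_
  cases o with
  | none => exact hU.isPi0_three
  | some i => exact IsSigma0.isPi0_three (isSigma0_two_iff.2 ⟨_, hH i, rfl⟩)

/-- Closedness of a set given by a strict inequality is what locally constant `a k` provide; it
makes "eventually within `ε`" a `Σ⁰₂` condition. -/
theorem IsPi0.three_tendsto {a : ℕ → X → ℝ} {c : ℝ}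
    (h : ∀ k ε, IsClosed {x | |a k x - c| < ε}) :
    IsPi0 3 {x | Tendsto (fun k => a k x) atTop (𝓝 c)} := by
  have : {x | Tendsto (fun k => a k x) atTop (𝓝 c)} =
      ⋂ m : ℕ, {x | ∀ᶠ k in atTop, x ∈ {x | |a k x - c| < 1 / ((m : ℝ) + 1)}} := by
    ext x
    simp only [Set.mem_ofPred_eq, Set.mem_iInter, Metric.tendsto_nhds, Real.dist_eq]
    refine ⟨fun H m => H _ (by positivity), fun H ε hε => ?_⟩
    obtain ⟨m, hm⟩ := exists_nat_one_div_lt hε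
    exact (H m).mono fun k hk => hk.trans hm
  rw [this]
  exact IsPi0.three_iInter fun m =>
    (IsSigma0.two_eventually fun k => h k _).isPi0_three

end BorelClasses

/-! ### Reduction of `Π⁰₃` sets to convergence to infinity -/

section Reduction

variable {X : Type*} [TopologicalSpace X]

theorem exists_clopen_iUnion_eq [SecondCountableTopology X]
    (hX : TopologicalSpace.IsTopologicalBasis {s : Set X | IsClopen s}) {U : Set X}
    (hU : IsOpen U) : ∃ W : ℕ → Set X, (∀ m, IsClopen (W m)) ∧ U = ⋃ m, W m := by
  obtain ⟨S, hS, rfl⟩ := hX.open_eq_sUnion hU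
  obtain ⟨T, hT, hTS, hTU⟩ :=
    TopologicalSpace.isOpen_sUnion_countable S fun s hs => (hS hs).isOpen
  -- The empty set is added so that an enumeration exists even if `T` is empty.
  obtain ⟨W, hW⟩ := (hT.insert ∅).exists_eq_range (Set.insert_nonempty _ _)
  refine ⟨W, fun m => ?_, ?_⟩
  · have : W m ∈ insert ∅ T := hW ▸ Set.mem_range_self m
    rcases this with h | h
    · rw [h]; exact isClopen_empty
    · exact hS (hTS h)
  · rw [← hTU, ← Set.sUnion_range, ← hW]
    simp

/-- Write the set as a decreasing intersection of open sets and cut each of them into disjoint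
clopen pieces. A point lies in at most one piece per level, so it meets infinitely many pieces only
if it belongs to infinitely many levels, hence to all. -/
theorem IsGδ.exists_clopen_frequently [SecondCountableTopology X]
    (hX : TopologicalSpace.IsTopologicalBasis {s : Set X | IsClopen s}) {G : Set X}
    (hG : IsGδ G) :
    ∃ V : ℕ → Set X, (∀ t, IsClopen (V t)) ∧ ∀ x, x ∈ G ↔ ∃ᶠ t in atTop, x ∈ V t := by
  obtain ⟨F, hF, rfl⟩ := isGδ_iff_eq_iInter_nat.1 hG
  have hO : ∀ n, IsOpen (⋂ i ∈ Set.Iic n, F i) := fun n =>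
    (Set.finite_Iic n).isOpen_biInter fun i _ => hF i
  choose W hW hOW using fun n => exists_clopen_iUnion_eq hX (hO n)
  have hclopen : ∀ n m, IsClopen (disjointed (W n) m) := fun n m =>
    disjointedRec (p := fun s => IsClopen s) (fun {s j} hs => hs.diff (hW n j)) (hW n m)
  refine ⟨fun t => disjointed (W t.unpair.1) t.unpair.2, fun t => hclopen _ _, fun x => ?_⟩
  have key : ∀ n, (∀ i ≤ n, x ∈ F i) ↔ ∃ m, x ∈ disjointed (W n) m := fun n => by
    rw [← Set.mem_iUnion, iUnion_disjointed, ← hOW]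
    simp
  constructor
  · intro hx
    rw [Set.mem_iInter] at hx
    choose m hm using fun n => (key n).1 fun i _ => hx i
    refine frequently_atTop.2 fun a => ⟨Nat.pair a (m a), Nat.left_le_pair _ _, ?_⟩
    simpa using hm a
  · intro hx
    rw [Set.mem_iInter]
    by_contra! hn
    obtain ⟨i, hi⟩ := hn
    refine Nat.frequently_atTop_iff_infinite.1 hx ?_
    refine Set.Finite.of_finite_image (f := fun t => t.unpair.1)
      ((Set.finite_lt_nat i).subset ?_) ?_
    · rintro _ ⟨t, ht, rfl⟩
      by_contra hlt
      exact hi ((key _).2 ⟨_, ht⟩ i (not_lt.1 hlt))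
    · intro s hs t ht hst
      have hst' : s.unpair.1 = t.unpair.1 := hst
      have h2 : s.unpair.2 = t.unpair.2 := by
        by_contra hne
        have hs' : x ∈ disjointed (W s.unpair.1) s.unpair.2 := hs
        have ht' : x ∈ disjointed (W t.unpair.1) t.unpair.2 := ht
        rw [← hst'] at ht'
        exact Set.disjoint_left.1 (disjoint_disjointed (W s.unpair.1) hne) hs' ht'
      rw [← Nat.pair_unpair s, ← Nat.pair_unpair t, hst', h2]

/-- Membership in the `i`-th `Σ⁰₂` set means meeting only finitely many clopen sets `V i t`. The
value at the code of `(i, t)` is `i` when `V i t` is met and large otherwise, so divergence says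
exactly that each `i` is signalled finitely often. -/
theorem IsPi0.three_exists_tendsto_atTop [SecondCountableTopology X]
    (hX : TopologicalSpace.IsTopologicalBasis {s : Set X | IsClopen s}) {C : Set X}
    (hC : IsPi0 3 C) :
    ∃ g : X → ℕ → ℕ, (∀ n, IsLocallyConstant fun x => g x n) ∧
      ∀ x, x ∈ C ↔ Tendsto (g x) atTop atTop := by
  obtain ⟨S, hS, rfl⟩ := hC
  have : ∀ i, ∃ V : ℕ → Set X, (∀ t, IsClopen (V t)) ∧
      ∀ x, x ∈ S i ↔ ∀ᶠ t in atTop, x ∉ V t := by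
    intro i
    obtain ⟨F, hF, hSF⟩ := isSigma0_two_iff.1 (hS i)
    have hG : IsGδ (S i)ᶜ := by
      rw [hSF, Set.compl_iUnion]
      exact IsGδ.iInter_of_isOpen fun j => (hF j).isOpen_compl
    obtain ⟨V, hV, h⟩ := hG.exists_clopen_frequently hX
    refine ⟨V, hV, fun x => ?_⟩
    rw [← not_iff_not, ← Set.mem_compl_iff, h]
    simp [Filter.Frequently]
  choose V hV hSV using this
  classical
  refine ⟨fun x p => if x ∈ V p.unpair.1 p.unpair.2 then p.unpair.1 else p, fun p => ?_,
    fun x => ?_⟩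
  · refine (IsLocallyConstant.iff_exists_open _).2 fun x => ?_
    by_cases hx : x ∈ V p.unpair.1 p.unpair.2
    · exact ⟨_, (hV _ _).isOpen, hx, fun y hy => by simp [hx, hy]⟩
    · exact ⟨_, (hV _ _).compl.isOpen, hx, fun y hy => by simp [hx, (Set.mem_compl_iff _ _).1 hy]⟩
  · simp only [Set.mem_iInter, hSV]
    constructor
    · intro hx
      refine tendsto_atTop.2 fun a => ?_
      choose T hT using fun i => eventually_atTop.1 (hx i)
      filter_upwards [eventually_ge_atTop a,
        eventually_ge_atTop ((Finset.range a).sup fun i => Nat.pair i (T i))] with p hpa hp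
      split_ifs with hxp
      · by_contra! hlt
        have h1 : Nat.pair p.unpair.1 (T p.unpair.1) ≤ p :=
          (Finset.le_sup (f := fun i => Nat.pair i (T i)) (Finset.mem_range.2 hlt)).trans hp
        refine hT _ p.unpair.2 ?_ hxp
        by_contra! h2
        have := Nat.pair_lt_pair_right p.unpair.1 h2
        rw [Nat.pair_unpair] at this
        omega
      · exact hpa
    · intro hx i
      have h1 := hx.eventually_gt_atTop i
      have h2 : Tendsto (fun t => Nat.pair i t) atTop atTop :=
        tendsto_atTop_mono (fun t => Nat.right_le_pair i t) tendsto_id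
      filter_upwards [h2.eventually h1] with t ht hxt
      simp [hxt] at ht

end Reduction

/-! ### Expansions -/

section Expansions

variable {b : ℕ}

theorem mul_ofDigits (d : ℕ → Fin b) :
    (b : ℝ) * Real.ofDigits d = (d 0 : ℕ) + Real.ofDigits fun i => d (i + 1) := by
  have hb : (b : ℝ) ≠ 0 := by
    have := Fin.pos (d 0)
    positivity
  rw [Real.ofDigits_eq_sum_add_ofDigits d 1]
  simp [Real.ofDigitsTerm]
  field_simp

theorem eq_zero_of_ofDigits_eq_zero {d : ℕ → Fin b} (h : Real.ofDigits d = 0) (i : ℕ) :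
    (d i : ℕ) = 0 := by
  have h1 := (hasSum_zero_iff_of_nonneg fun _ => Real.ofDigitsTerm_nonneg).1
    (h ▸ Real.summable_ofDigitsTerm.hasSum : HasSum (Real.ofDigitsTerm d) 0)
  have h2 := congrFun h1 i
  have := Fin.pos (d 0)
  simpa [Real.ofDigitsTerm, this.ne'] using h2

/-- The tail has value at most one, so value one forces the largest first digit and a tail of value
one again. -/
theorem eq_last_of_ofDigits_eq_one (i : ℕ) : ∀ {d : ℕ → Fin b}, Real.ofDigits d = 1 →
    (d i : ℕ) + 1 = b := by
  have key : ∀ {d : ℕ → Fin b}, Real.ofDigits d = 1 →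
      (d 0 : ℕ) + 1 = b ∧ Real.ofDigits (fun i => d (i + 1)) = 1 := by
    intro d h
    have h1 := mul_ofDigits d
    have h2 := Real.ofDigits_le_one fun i => d (i + 1)
    rw [h, mul_one] at h1
    have h3 : (d 0 : ℕ) + 1 = b := by
      refine le_antisymm (d 0).2 ?_
      have : (b : ℝ) ≤ (((d 0 : ℕ) + 1 : ℕ) : ℝ) := by push_cast; linarith
      exact_mod_cast this
    have h4 : (((d 0 : ℕ) + 1 : ℕ) : ℝ) = b := by rw [h3]
    push_cast at h4
    exact ⟨h3, by linarith⟩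
  induction i with
  | zero => exact fun h => (key h).1
  | succ i ih => exact fun h => ih (key h).2

theorem exists_pow_mul_ofDigits (d : ℕ → Fin b) (n : ℕ) :
    ∃ z : ℕ, (b : ℝ) ^ n * Real.ofDigits d = z + Real.ofDigits fun i => d (i + n) := by
  induction n with
  | zero => exact ⟨0, by simp⟩
  | succ n ih =>
    obtain ⟨z, hz⟩ := ih
    refine ⟨b * z + d n, ?_⟩
    rw [pow_succ', mul_assoc, hz, mul_add, mul_ofDigits]
    push_cast
    simp only [zero_add, add_assoc, add_comm 1 n]

theorem frequently_shift {d : ℕ → Fin b} (h : ∃ᶠ j in atTop, (d j : ℕ) ≠ 0) (n : ℕ) :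
    ∃ i, (d (i + n) : ℕ) ≠ 0 := by
  obtain ⟨m, hm, h⟩ := frequently_atTop.1 h n
  exact ⟨m - n, by rwa [Nat.sub_add_cancel hm]⟩

/-- If the first digits differed, the sequence with the larger one would need a tail of value zero,
contrary to its infinitely many nonzero digits. Shifting gives the other digits. -/
theorem ofDigits_injective {d e : ℕ → Fin b} (h : Real.ofDigits d = Real.ofDigits e)
    (hd : ∃ᶠ j in atTop, (d j : ℕ) ≠ 0) (he : ∃ᶠ j in atTop, (e j : ℕ) ≠ 0) : d = e := by
  have aux : ∀ {d e : ℕ → Fin b}, Real.ofDigits d = Real.ofDigits e →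
      (∃ᶠ j in atTop, (d j : ℕ) ≠ 0) → (d 0 : ℕ) ≤ e 0 := by
    intro d e h hd
    by_contra! hlt
    have h1 := mul_ofDigits d
    have h2 := mul_ofDigits e
    have h3 := Real.ofDigits_le_one fun i => e (i + 1)
    have h4 := Real.ofDigits_nonneg fun i => d (i + 1)
    have h5 : ((e 0 : ℕ) : ℝ) + 1 ≤ (d 0 : ℕ) := by exact_mod_cast hlt
    rw [h] at h1
    have h6 : Real.ofDigits (fun i => d (i + 1)) = 0 := by linarith
    obtain ⟨i, hi⟩ := frequently_shift hd 1
    exact hi (eq_zero_of_ofDigits_eq_zero h6 i)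
  have main : ∀ n, ∀ {d e : ℕ → Fin b}, Real.ofDigits d = Real.ofDigits e →
      (∃ᶠ j in atTop, (d j : ℕ) ≠ 0) → (∃ᶠ j in atTop, (e j : ℕ) ≠ 0) → d n = e n := by
    intro n
    have h0 : ∀ {d e : ℕ → Fin b}, Real.ofDigits d = Real.ofDigits e →
      (∃ᶠ j in atTop, (d j : ℕ) ≠ 0) → (∃ᶠ j in atTop, (e j : ℕ) ≠ 0) → d 0 = e 0 :=
      fun h hd he => Fin.ext (le_antisymm (aux h hd) (aux h.symm he))
    have hs : ∀ {d : ℕ → Fin b}, (∃ᶠ j in atTop, (d j : ℕ) ≠ 0) →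
        ∃ᶠ j in atTop, (d (j + 1) : ℕ) ≠ 0 := by
      intro d hd
      refine frequently_atTop.2 fun a => ?_
      obtain ⟨m, hm, h⟩ := frequently_atTop.1 hd (a + 1)
      exact ⟨m - 1, by omega, by rwa [Nat.sub_add_cancel (by omega)]⟩
    induction n with
    | zero => exact h0
    | succ n ih =>
      intro d e h hd he
      refine ih (d := fun i => d (i + 1)) (e := fun i => e (i + 1)) ?_ (hs hd) (hs he)
      have h1 := mul_ofDigits d
      have h2 := mul_ofDigits e
      rw [h, h0 h hd he] at h1
      linarith
  exact funext fun n => main n h hd he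

theorem IsExpansion.unique {x : ℝ} {d e : ℕ → Fin b} (hd : IsExpansion b x d)
    (he : IsExpansion b x e) : d = e :=
  ofDigits_injective (hd.1.trans he.1.symm) hd.2 he.2

theorem IsExpansion.mem_normalNumbers_iff {x : ℝ} {d : ℕ → Fin b} (hd : IsExpansion b x d) :
    x ∈ normalNumbers b ↔ IsNormalSeq d :=
  ⟨fun ⟨_, he, h⟩ => hd.unique he ▸ h, fun h => ⟨d, hd, h⟩⟩

theorem IsExpansion.mem_poissonGenericNumbers_iff {x : ℝ} {d : ℕ → Fin b}
    (hd : IsExpansion b x d) : x ∈ poissonGenericNumbers b ↔ IsPoissonGenericSeq d :=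
  ⟨fun ⟨_, he, h⟩ => hd.unique he ▸ h, fun h => ⟨d, hd, h⟩⟩

/-- The real numbers whose base `b` expansion does not terminate. -/
def nonterminating (b : ℕ) : Set ℝ :=
  {x | ∀ (n : ℕ) (z : ℤ), x * (b : ℝ) ^ n ≠ z}

theorem isGδ_nonterminating (hb : 2 ≤ b) : IsGδ (nonterminating b) := by
  have : nonterminating b = (Set.range fun p : ℕ × ℤ => (p.2 : ℝ) / (b : ℝ) ^ p.1)ᶜ := by
    ext x
    have hpos : ∀ (n : ℕ) (z : ℤ), x * (b : ℝ) ^ n = z ↔ (z : ℝ) / (b : ℝ) ^ n = x := fun n z => by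
      rw [div_eq_iff (by positivity), eq_comm]
    simp [nonterminating, hpos]
  rw [this]
  exact (Set.countable_range _).isGδ_compl

theorem isExpansion_digits [NeZero b] (hb : 2 ≤ b) {x : ℝ} (hx : x ∈ nonterminating b) :
    IsExpansion b x (Real.digits (Int.fract x) b) := by
  have h := Real.ofDigits_digits (b := b) (x := Int.fract x) hb
    ⟨Int.fract_nonneg x, Int.fract_lt_one x⟩
  refine ⟨h, fun hev => ?_⟩
  obtain ⟨n, hn⟩ := eventually_atTop.1 hev
  obtain ⟨z, hz⟩ := exists_pow_mul_ofDigits (Real.digits (Int.fract x) b) n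
  have h0 : Real.ofDigits (fun i => Real.digits (Int.fract x) b (i + n)) = 0 := by
    have : ∀ i, (Real.digits (Int.fract x) b (i + n) : ℕ) = 0 := fun i => by
      simpa using hn (i + n) (by omega)
    simp [Real.ofDigits, Real.ofDigitsTerm, this]
  rw [h, h0, Int.fract] at hz
  refine hx n (z + ⌊x⌋ * (b : ℤ) ^ n) ?_
  push_cast
  linarith

/-- For nonterminating `x` the number `x * b ^ n` is never an integer, so its floor does not jump at
`x`; each digit is a function of two such floors, the one for `n = 0` removing the integer part. -/
theorem isLocallyConstant_digits [NeZero b] (i : ℕ) :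
    IsLocallyConstant fun x : nonterminating b => Real.digits (Int.fract (x : ℝ)) b i := by
  have hfl : ∀ n : ℕ, IsLocallyConstant fun x : nonterminating b => ⌊(x : ℝ) * (b : ℝ) ^ n⌋ := by
    intro n
    refine (IsLocallyConstant.iff_eventually_eq _).2 fun x => ?_
    have hc : Continuous fun y : nonterminating b => (y : ℝ) * (b : ℝ) ^ n := by fun_prop
    have hlt : (⌊(x : ℝ) * (b : ℝ) ^ n⌋ : ℝ) < (x : ℝ) * (b : ℝ) ^ n :=
      lt_of_le_of_ne (Int.floor_le _) (x.2 n _).symm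
    filter_upwards [hc.continuousAt.eventually (lt_mem_nhds hlt),
      hc.continuousAt.eventually (gt_mem_nhds (Int.lt_floor_add_one _))] with y h1 h2
    exact Int.floor_eq_iff.2 ⟨h1.le, h2⟩
  have hd : ∀ x : nonterminating b, Real.digits (Int.fract (x : ℝ)) b i =
      Fin.ofNat b (⌊(x : ℝ) * (b : ℝ) ^ (i + 1)⌋ -
        ⌊(x : ℝ) * (b : ℝ) ^ 0⌋ * (b : ℤ) ^ (i + 1)).toNat := by
    intro x
    simp only [Real.digits, Int.fract, pow_zero, mul_one]
    rw [← Int.floor_toNat, sub_mul]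
    congr 2
    rw [← Int.floor_sub_intCast]
    push_cast
    rfl
  simp only [hd]
  exact ((hfl (i + 1)).prodMk (hfl 0)).comp
    fun p : ℤ × ℤ => Fin.ofNat b (p.1 - p.2 * (b : ℤ) ^ (i + 1)).toNat

end Expansions

/-! ### Counting windows -/

section Windows

variable {b : ℕ}

/-- The word of length `k` that is read in `d` from position `i` on. -/
def window (d : ℕ → Fin b) (k i : ℕ) : Fin k → Fin b := fun t => d (i + t)

/-- The number of occurrences of `w` in `d` that start before `n`. -/
def startCount (d : ℕ → Fin b) {k : ℕ} (w : Fin k → Fin b) (n : ℕ) : ℕ :=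
  ((Finset.range n).filter fun i => window d k i = w).card

/-- The proportion of words of length `k` with exactly `j` occurrences in `d` that start
before `n`. -/
noncomputable def wordRatio (d : ℕ → Fin b) (k j n : ℕ) : ℝ :=
  1 / (b : ℝ) ^ k *
    ((Finset.univ.filter fun w : Fin k → Fin b => startCount d w n = j).card : ℝ)

theorem window_eq_iff {d : ℕ → Fin b} {k i : ℕ} {w : Fin k → Fin b} :
    window d k i = w ↔ ∀ t : Fin k, d (i + t) = w t :=
  funext_iff

theorem window_congr {d e : ℕ → Fin b} {k i j : ℕ} (h : ∀ t < k, d (i + t) = e (j + t)) :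
    window d k i = window e k j :=
  funext fun t => h t t.2

theorem occurrences_eq (d : ℕ → Fin b) {k : ℕ} (w : Fin k → Fin b) (N : ℕ) :
    occurrences d w N = startCount d w (N + 1 - k) := by
  unfold occurrences startCount
  congr 1
  ext i
  simp only [Finset.mem_filter, Finset.mem_range, window_eq_iff]
  constructor
  · rintro ⟨_, h, h'⟩
    exact ⟨by omega, h'⟩
  · rintro ⟨h, h'⟩
    exact ⟨by omega, by omega, h'⟩

/-- The extra `k` digits in the definition make the number of starting positions independent of the
word length, apart from the factor `b ^ k`. -/
theorem poissonCount_eq {l : ℝ} (hl : 0 ≤ l) (j k : ℕ) (d : ℕ → Fin b) :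
    poissonCount l j k d = wordRatio d k j (⌊l * (b : ℝ) ^ k⌋₊ + 1) := by
  have : ⌊l * (b : ℝ) ^ k + (k : ℝ)⌋₊ + 1 - k = ⌊l * (b : ℝ) ^ k⌋₊ + 1 := by
    rw [Nat.floor_add_natCast (by positivity)]
    omega
  simp only [poissonCount, wordRatio, occurrences_eq, this]

theorem startCount_succ (d : ℕ → Fin b) {k : ℕ} (w : Fin k → Fin b) (n : ℕ) :
    startCount d w (n + 1) = startCount d w n + if window d k n = w then 1 else 0 := by
  unfold startCount
  rw [Finset.range_add_one, Finset.filter_insert]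
  split_ifs with h
  · rw [Finset.card_insert_of_notMem (by simp)]
  · rfl

theorem startCount_mono (d : ℕ → Fin b) {k : ℕ} (w : Fin k → Fin b) : Monotone (startCount d w) :=
  monotone_nat_of_le_succ fun n => by rw [startCount_succ]; omega

theorem startCount_add_le (d : ℕ → Fin b) {k : ℕ} (w : Fin k → Fin b) (n m : ℕ) :
    startCount d w (n + m) ≤ startCount d w n + m := by
  induction m with
  | zero => rfl
  | succ m ih =>
    rw [← add_assoc, startCount_succ]
    split_ifs <;> omega

theorem abs_startCount_sub_le (d : ℕ → Fin b) {k : ℕ} (w : Fin k → Fin b) {m n : ℕ} (h : m ≤ n) :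
    |(startCount d w n : ℝ) - startCount d w m| ≤ n - m := by
  have h1 := startCount_mono d w h
  have h2 := startCount_add_le d w m (n - m)
  rw [Nat.add_sub_cancel' h] at h2
  rw [abs_of_nonneg (by simpa using h1)]
  have : startCount d w n + m ≤ startCount d w m + n := by omega
  have : (startCount d w n : ℝ) + m ≤ startCount d w m + n := by exact_mod_cast this
  linarith

/-- Positions at which the windows of two sequences differ. -/
def windowDiff (d e : ℕ → Fin b) (k n : ℕ) : Finset ℕ :=
  (Finset.range n).filter fun i => window d k i ≠ window e k i

theorem startCount_le_add_windowDiff (d e : ℕ → Fin b) {k : ℕ} (w : Fin k → Fin b) (n : ℕ) :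
    startCount d w n ≤ startCount e w n + (windowDiff d e k n).card := by
  refine (Finset.card_le_card ?_).trans (Finset.card_union_le _ _)
  intro i hi
  simp only [windowDiff, Finset.mem_filter, Finset.mem_union, Finset.mem_range] at hi ⊢
  by_cases h : window d k i = window e k i
  · exact Or.inl ⟨hi.1, h ▸ hi.2⟩
  · exact Or.inr ⟨hi.1, h⟩

theorem windowDiff_comm (d e : ℕ → Fin b) (k n : ℕ) : windowDiff d e k n = windowDiff e d k n := by
  simp [windowDiff, ne_comm]

theorem abs_startCount_sub_le_windowDiff (d e : ℕ → Fin b) {k : ℕ} (w : Fin k → Fin b) (n : ℕ) :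
    |(startCount d w n : ℝ) - startCount e w n| ≤ (windowDiff d e k n).card := by
  have h1 := startCount_le_add_windowDiff d e w n
  have h2 := startCount_le_add_windowDiff e d w n
  rw [windowDiff_comm] at h2
  have h1' : (startCount d w n : ℝ) ≤ startCount e w n + (windowDiff d e k n).card := by
    exact_mod_cast h1
  have h2' : (startCount e w n : ℝ) ≤ startCount d w n + (windowDiff d e k n).card := by
    exact_mod_cast h2
  rw [abs_le]
  constructor <;> linarith

theorem startCount_eq_of_forall_windowDiff (d e : ℕ → Fin b) {k : ℕ} (w : Fin k → Fin b) (n : ℕ)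
    (h : ∀ i ∈ windowDiff d e k n, window d k i ≠ w ∧ window e k i ≠ w) :
    startCount d w n = startCount e w n := by
  unfold startCount
  congr 1
  refine Finset.filter_congr fun i hi => ?_
  by_cases hne : window d k i = window e k i
  · rw [hne]
  · have := h i (Finset.mem_filter.2 ⟨hi, hne⟩)
    simp [this.1, this.2]

/-- A position where the windows differ affects only two words: the one read in `d` and the one read
in `e`. -/
theorem wordRatio_le_add_windowDiff (d e : ℕ → Fin b) (k j n : ℕ) :
    wordRatio d k j n ≤ wordRatio e k j n + 1 / (b : ℝ) ^ k * (2 * (windowDiff d e k n).card) := by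
  unfold wordRatio
  rw [← mul_add]
  refine mul_le_mul_of_nonneg_left ?_ (by positivity)
  have : (Finset.univ.filter fun w : Fin k → Fin b => startCount d w n = j) ⊆
      (Finset.univ.filter fun w : Fin k → Fin b => startCount e w n = j) ∪
        ((windowDiff d e k n).image (window d k) ∪ (windowDiff d e k n).image (window e k)) := by
    intro w hw
    simp only [Finset.mem_union, Finset.mem_filter, Finset.mem_univ, true_and,
      Finset.mem_image] at hw ⊢
    by_contra! hcon
    exact hcon.1 (hw ▸ (startCount_eq_of_forall_windowDiff d e w n
      fun i hi => ⟨hcon.2.1 i hi, hcon.2.2 i hi⟩).symm)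
  have h1 := (Finset.card_le_card this).trans (Finset.card_union_le _ _)
  have h2 := Finset.card_union_le ((windowDiff d e k n).image (window d k))
    ((windowDiff d e k n).image (window e k))
  have h3 := Finset.card_image_le (s := windowDiff d e k n) (f := window d k)
  have h4 := Finset.card_image_le (s := windowDiff d e k n) (f := window e k)
  have h5 : (Finset.univ.filter fun w : Fin k → Fin b => startCount d w n = j).card ≤
      (Finset.univ.filter fun w : Fin k → Fin b => startCount e w n = j).card +
        2 * (windowDiff d e k n).card := by omega
  exact_mod_cast h5

theorem abs_wordRatio_sub_le (d e : ℕ → Fin b) (k j n : ℕ) :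
    |wordRatio d k j n - wordRatio e k j n| ≤
      1 / (b : ℝ) ^ k * (2 * (windowDiff d e k n).card) := by
  have h1 := wordRatio_le_add_windowDiff d e k j n
  have h2 := wordRatio_le_add_windowDiff e d k j n
  rw [windowDiff_comm] at h2
  rw [abs_le]
  constructor <;> linarith

theorem sum_wordRatio (d : ℕ → Fin b) (k J n : ℕ) :
    ∑ j ∈ Finset.range J, wordRatio d k j n =
      1 / (b : ℝ) ^ k *
        ((Finset.univ.filter fun w : Fin k → Fin b => startCount d w n < J).card : ℝ) := by
  simp only [wordRatio, ← Finset.mul_sum]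
  congr 1
  rw [Finset.card_eq_sum_card_fiberwise (f := fun w => startCount d w n) (t := Finset.range J)]
  · push_cast
    refine Finset.sum_congr rfl fun j hj => ?_
    congr 2
    ext w
    simp only [Finset.mem_filter, Finset.mem_univ, true_and, Finset.mem_range] at hj ⊢
    omega
  · intro w hw
    simpa using hw

/-- Counts grow with the length, so cumulative proportions are monotone, which single proportions
are not. -/
theorem sum_wordRatio_anti (d : ℕ → Fin b) (k J : ℕ) {m n : ℕ} (h : m ≤ n) :
    ∑ j ∈ Finset.range J, wordRatio d k j n ≤ ∑ j ∈ Finset.range J, wordRatio d k j m := by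
  rw [sum_wordRatio, sum_wordRatio]
  refine mul_le_mul_of_nonneg_left ?_ (by positivity)
  refine Nat.cast_le.2 (Finset.card_le_card fun w hw => ?_)
  simp only [Finset.mem_filter, Finset.mem_univ, true_and] at hw ⊢
  exact (startCount_mono d w h).trans_lt hw

theorem isNormalSeq_iff {d : ℕ → Fin b} :
    IsNormalSeq d ↔ ∀ (k : ℕ) (w : Fin k → Fin b),
      Tendsto (fun n : ℕ => (startCount d w n : ℝ) / n) atTop (𝓝 (1 / (b : ℝ) ^ k)) := by
  refine forall₂_congr fun k w => ?_
  have hdiff : Tendsto (fun n : ℕ => (occurrences d w n : ℝ) / n - (startCount d w n : ℝ) / n)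
      atTop (𝓝 0) := by
    refine squeeze_zero_norm (a := fun n : ℕ => ((k : ℝ) + 1) / n) (fun n => ?_)
      (tendsto_const_div_atTop_nhds_zero_nat _)
    rw [← sub_div, norm_div, Real.norm_eq_abs, Real.norm_natCast, occurrences_eq]
    refine div_le_div_of_nonneg_right ?_ (by positivity)
    -- For the empty word there are `n + 1` starting positions, more than `n`; for `k > 0` there are
    -- at most `n`.
    rcases Nat.eq_zero_or_pos k with rfl | hk
    · have := abs_startCount_sub_le d w (Nat.le_succ n)
      push_cast at this
      simpa using this
    · rw [abs_sub_comm]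
      refine (abs_startCount_sub_le d w (show n + 1 - k ≤ n by omega)).trans ?_
      have : n ≤ n + 1 - k + k := by omega
      have : (n : ℝ) ≤ (n + 1 - k : ℕ) + k := by exact_mod_cast this
      linarith
  constructor
  · intro h
    simpa using h.sub hdiff
  · intro h
    simpa using h.add hdiff

/-- A real parameter is squeezed between rational ones: the cumulative proportions are monotone in
the parameter and their limits are continuous in it. -/
theorem isPoissonGenericSeq_of_rat {d : ℕ → Fin b}
    (h : ∀ l : ℚ, 0 < l → ∀ j : ℕ, Tendsto (fun k : ℕ => poissonCount (l : ℝ) j k d) atTop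
      (𝓝 (Real.exp (-l) * l ^ j / (j.factorial : ℝ)))) : IsPoissonGenericSeq d := by
  intro l hl j
  let S : ℝ → ℕ → ℝ := fun l J => ∑ j ∈ Finset.range J, Real.exp (-l) * l ^ j / (j.factorial : ℝ)
  have hS : ∀ J, Continuous fun l => S l J := fun J => by fun_prop
  have hrat : ∀ l : ℚ, 0 < l → ∀ J, Tendsto (fun k => ∑ j ∈ Finset.range J,
      wordRatio d k j (⌊(l : ℝ) * (b : ℝ) ^ k⌋₊ + 1)) atTop (𝓝 (S l J)) := by
    intro l hl J
    refine tendsto_finsetSum _ fun j _ => ?_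
    simpa only [poissonCount_eq (Rat.cast_nonneg.2 hl.le)] using h l hl j
  have hreal : ∀ J, Tendsto (fun k => ∑ j ∈ Finset.range J,
      wordRatio d k j (⌊l * (b : ℝ) ^ k⌋₊ + 1)) atTop (𝓝 (S l J)) := by
    intro J
    have hmono : ∀ {x y : ℝ}, x ≤ y → ∀ k, ⌊x * (b : ℝ) ^ k⌋₊ + 1 ≤ ⌊y * (b : ℝ) ^ k⌋₊ + 1 :=
      fun hxy k => Nat.add_le_add_right (Nat.floor_mono
        (mul_le_mul_of_nonneg_right hxy (by positivity))) 1
    refine tendsto_order.2 ⟨fun a ha => ?_, fun a ha => ?_⟩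
    · obtain ⟨ε, hε, hball⟩ := Metric.eventually_nhds_iff.1
        ((hS J).continuousAt.eventually (lt_mem_nhds ha))
      obtain ⟨r, hr1, hr2⟩ := exists_rat_btwn (lt_add_of_pos_right l hε)
      have hr : a < S r J := hball (by rw [Real.dist_eq, abs_lt]; constructor <;> linarith)
      filter_upwards [(hrat r (by exact_mod_cast hl.trans hr1) J).eventually (lt_mem_nhds hr)]
        with k hk
      exact hk.trans_le (sum_wordRatio_anti d k J (hmono hr1.le k))
    · obtain ⟨ε, hε, hball⟩ := Metric.eventually_nhds_iff.1
        ((hS J).continuousAt.eventually (gt_mem_nhds ha))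
      obtain ⟨r, hr1, hr2⟩ := exists_rat_btwn (max_lt (sub_lt_self l hε) hl)
      obtain ⟨hr0, hr1⟩ := max_lt_iff.1 hr1
      have hr : S r J < a := hball (by rw [Real.dist_eq, abs_lt]; constructor <;> linarith)
      filter_upwards [(hrat r (by exact_mod_cast hr1) J).eventually (gt_mem_nhds hr)]
        with k hk
      exact (sum_wordRatio_anti d k J (hmono hr2.le k)).trans_lt hk
  -- A single probability is the difference of two consecutive cumulative ones.
  have := (hreal (j + 1)).sub (hreal j)
  simpa [S, Finset.sum_range_succ, poissonCount_eq hl.le] using this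

/-! ### Functions of finitely many digits -/

theorem dependsOn_startCount {k : ℕ} (w : Fin k → Fin b) (n : ℕ) :
    DependsOn (fun d : ℕ → Fin b => startCount d w n) (Set.Iio (n + k)) := by
  intro d e h
  refine startCount_eq_of_forall_windowDiff d e w n fun i hi => ?_
  obtain ⟨hi, hne⟩ := Finset.mem_filter.1 hi
  exact absurd (window_congr fun t ht => h _ (by have := Finset.mem_range.1 hi; simp; omega)) hne

theorem dependsOn_wordRatio (k j n : ℕ) :
    DependsOn (fun d : ℕ → Fin b => wordRatio d k j n) (Set.Iio (n + k)) := by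
  intro d e h
  have : ∀ w : Fin k → Fin b, startCount d w n = startCount e w n :=
    fun w => dependsOn_startCount w n h
  simp [wordRatio, this]

theorem DependsOn.isLocallyConstant {α : Type*} {f : (ℕ → Fin b) → α} {m : ℕ}
    (hf : DependsOn f (Set.Iio m)) : IsLocallyConstant f := by
  refine (IsLocallyConstant.iff_exists_open f).2 fun x =>
    ⟨⋂ i ∈ Set.Iio m, (fun y : ℕ → Fin b => y i) ⁻¹' {x i}, ?_, by simp, fun y hy => ?_⟩
  · exact (Set.finite_Iio m).isOpen_biInter fun i _ =>
      (isOpen_discrete _).preimage (continuous_apply i)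
  · exact hf fun i hi => by simpa using Set.mem_iInter₂.1 hy i hi

theorem isPi0_three_isNormalSeq : IsPi0 3 {d : ℕ → Fin b | IsNormalSeq d} := by
  have : {d : ℕ → Fin b | IsNormalSeq d} = ⋂ p : Σ k : ℕ, Fin k → Fin b,
      {d | Tendsto (fun n : ℕ => (startCount d p.2 n : ℝ) / n) atTop
        (𝓝 (1 / (b : ℝ) ^ p.1))} := by
    ext d
    simp [isNormalSeq_iff, Sigma.forall]
  rw [this]
  have : Nonempty (Σ k : ℕ, Fin k → Fin b) := ⟨⟨0, Fin.elim0⟩⟩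
  refine IsPi0.three_iInter fun p => IsPi0.three_tendsto fun n ε => ?_
  -- The distance to the limit is a function of finitely many digits, so each of its sublevel sets
  -- has an open complement.
  exact ⟨((dependsOn_startCount p.2 n).isLocallyConstant.comp
    fun m : ℕ => |(m : ℝ) / n - 1 / (b : ℝ) ^ p.1|) (Set.Iio ε)ᶜ⟩

theorem isPi0_three_isPoissonGenericSeq : IsPi0 3 {d : ℕ → Fin b | IsPoissonGenericSeq d} := by
  have : {d : ℕ → Fin b | IsPoissonGenericSeq d} = ⋂ p : {l : ℚ // 0 < l} × ℕ,
      {d | Tendsto (fun k : ℕ => poissonCount (p.1 : ℝ) p.2 k d) atTop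
        (𝓝 (Real.exp (-(p.1 : ℝ)) * (p.1 : ℝ) ^ p.2 / (p.2.factorial : ℝ)))} := by
    ext d
    simp only [Set.mem_iInter]
    exact ⟨fun h p => h p.1 (Rat.cast_pos.2 p.1.2) p.2,
      fun h => isPoissonGenericSeq_of_rat fun l hl j => h (⟨l, hl⟩, j)⟩
  rw [this]
  have : Nonempty ({l : ℚ // 0 < l} × ℕ) := ⟨⟨⟨1, one_pos⟩, 0⟩⟩
  refine IsPi0.three_iInter fun p => IsPi0.three_tendsto fun k ε => ?_
  simp only [poissonCount_eq (Rat.cast_nonneg.2 p.1.2.le)]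
  exact ⟨((dependsOn_wordRatio k p.2 _).isLocallyConstant.comp fun m : ℝ =>
    |m - Real.exp (-(p.1 : ℝ)) * (p.1 : ℝ) ^ p.2 / (p.2.factorial : ℝ)|) (Set.Iio ε)ᶜ⟩

-- Normal numbers are nonterminating, and the upper bound

/-- An eventually constant sequence is not normal. -/
theorem IsNormalSeq.frequently_ne (hb : 2 ≤ b) {d : ℕ → Fin b} (hd : IsNormalSeq d)
    (a : Fin b) : ∃ᶠ i in atTop, d i ≠ a := by
  intro hev
  obtain ⟨N, hN⟩ := eventually_atTop.1 hev
  have h := isNormalSeq_iff.1 hd 1 fun _ => a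
  have hlow : ∀ n : ℕ, (n : ℝ) - N ≤ startCount d (fun _ : Fin 1 => a) n := by
    intro n
    have : n ≤ startCount d (fun _ : Fin 1 => a) n + N := by
      induction n with
      | zero => simp
      | succ n ih =>
        rw [startCount_succ]
        by_cases hn : N ≤ n
        · have : d n = a := by simpa using hN n hn
          rw [if_pos (by ext; simp [window, this])]
          omega
        · omega
    have : (n : ℝ) ≤ startCount d (fun _ : Fin 1 => a) n + N := by exact_mod_cast this
    linarith
  -- The letter `a` would have frequency at least one, while normality gives it `1 / b ≤ 1 / 2`.
  have h1 : Tendsto (fun n : ℕ => 1 - (N : ℝ) / n) atTop (𝓝 (1 - 0)) :=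
    tendsto_const_nhds.sub (tendsto_const_div_atTop_nhds_zero_nat _)
  have h2 := le_of_tendsto_of_tendsto h1 h (by
    filter_upwards [eventually_gt_atTop 0] with n hn
    have hn' : (0 : ℝ) < n := by exact_mod_cast hn
    rw [le_div_iff₀ hn', sub_mul, div_mul_cancel₀ _ hn'.ne', one_mul]
    exact hlow n)
  have hb' : (2 : ℝ) ≤ b := by exact_mod_cast hb
  rw [pow_one, sub_zero, le_div_iff₀ (by linarith)] at h2
  linarith

/-- If `x * b ^ n` were an integer, the tail from `n` on would have value zero or one. Zero
contradicts the choice of expansion, and one means that all later digits are `b - 1`, which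
normality forbids. -/
theorem IsExpansion.mem_nonterminating (hb : 2 ≤ b) {x : ℝ} {d : ℕ → Fin b}
    (hx : IsExpansion b x d) (hd : IsNormalSeq d) : x ∈ nonterminating b := by
  intro n z hz
  obtain ⟨m, hm⟩ := exists_pow_mul_ofDigits d n
  have h0 := Real.ofDigits_nonneg fun i => d (i + n)
  have h1 := Real.ofDigits_le_one fun i => d (i + n)
  have hint : Real.ofDigits (fun i => d (i + n)) = ((z - ⌊x⌋ * (b : ℤ) ^ n - m : ℤ) : ℝ) := by
    rw [hx.1, Int.fract] at hm
    push_cast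
    linarith
  rw [hint] at h0 h1
  have h0' : 0 ≤ z - ⌊x⌋ * (b : ℤ) ^ n - m := by exact_mod_cast h0
  have h1' : z - ⌊x⌋ * (b : ℤ) ^ n - m ≤ 1 := by exact_mod_cast h1
  obtain h | h : z - ⌊x⌋ * (b : ℤ) ^ n - m = 0 ∨ z - ⌊x⌋ * (b : ℤ) ^ n - m = 1 := by omega
  · rw [h, Int.cast_zero] at hint
    obtain ⟨i, hi⟩ := frequently_shift hx.2 n
    exact hi (eq_zero_of_ofDigits_eq_zero hint i)
  · rw [h, Int.cast_one] at hint
    obtain ⟨i, hi, hne⟩ := frequently_atTop.1 (hd.frequently_ne hb ⟨b - 1, by omega⟩) n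
    refine hne (Fin.ext ?_)
    have := eq_last_of_ofDigits_eq_one (i - n) hint
    rw [Nat.sub_add_cancel hi] at this
    simp only
    omega

/-- Both sets are cut down to the nonterminating numbers, where the digit map is continuous. The
difference does not change, because every normal number is nonterminating. -/
theorem isD2Pi03_normal_diff_poissonGeneric (hb : 2 ≤ b) :
    IsD2Pi03 (normalNumbers b \ poissonGenericNumbers b) := by
  have : NeZero b := ⟨by omega⟩
  let δ : nonterminating b → ℕ → Fin b := fun x => Real.digits (Int.fract (x : ℝ)) b
  have hδ : Continuous δ := continuous_pi fun i => (isLocallyConstant_digits i).continuous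
  have hexp : ∀ x : nonterminating b, IsExpansion b x (δ x) := fun x => isExpansion_digits hb x.2
  refine ⟨_, _, (isPi0_three_isNormalSeq.three_preimage hδ).three_image_val
    (isGδ_nonterminating hb), (isPi0_three_isPoissonGenericSeq.three_preimage hδ).three_image_val
    (isGδ_nonterminating hb), ?_⟩
  ext x
  simp only [Set.mem_sdiff, Set.mem_image, Set.mem_preimage, Set.mem_ofPred_eq, Subtype.exists,
    exists_and_right, exists_eq_right]
  constructor
  · rintro ⟨⟨d, hxd, hd⟩, hP⟩
    have hx := hxd.mem_nonterminating hb hd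
    refine ⟨⟨hx, hxd.unique (hexp ⟨x, hx⟩) ▸ hd⟩, ?_⟩
    rintro ⟨_, h⟩
    exact hP ⟨_, hexp ⟨x, hx⟩, h⟩
  · rintro ⟨⟨hx, hd⟩, hP⟩
    refine ⟨⟨_, hexp ⟨x, hx⟩, hd⟩, fun h => hP ⟨hx, ?_⟩⟩
    exact (hexp ⟨x, hx⟩).mem_poissonGenericNumbers_iff.1 h

end Windows

/-! ### Random digits -/

section RandomDigits

open MeasureTheory ProbabilityTheory

variable {b : ℕ} [NeZero b]

/-- The distribution of a sequence of independent uniformly distributed digits. -/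
noncomputable def digitMeasure (b : ℕ) [NeZero b] : Measure (ℕ → Fin b) :=
  Measure.infinitePi fun _ => (PMF.uniformOfFintype (Fin b)).toMeasure

instance : IsProbabilityMeasure (digitMeasure b) := by
  unfold digitMeasure
  infer_instance

theorem DependsOn.exists_eq_restrict {α : Type*} {f : (ℕ → Fin b) → α} {m : ℕ}
    (hf : DependsOn f (Set.Iio m)) :
    ∃ g : (Finset.range m → Fin b) → α, ∀ y, f y = g fun i => y i :=
  -- The digits from `m` on are irrelevant to `f` and are filled with zeros.
  ⟨fun v => f fun i => if h : i ∈ Finset.range m then v ⟨i, h⟩ else 0, fun y => hf fun i hi => by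
    have hi' : i < m := hi
    simp [hi']⟩

theorem DependsOn.measurable_digits {f : (ℕ → Fin b) → ℝ} {m : ℕ}
    (hf : DependsOn f (Set.Iio m)) : Measurable f := by
  obtain ⟨g, hg⟩ := hf.exists_eq_restrict
  rw [funext hg]
  exact (Measurable.of_discrete (f := g)).comp (by fun_prop)

theorem DependsOn.integrable_digits {f : (ℕ → Fin b) → ℝ} {m : ℕ}
    (hf : DependsOn f (Set.Iio m)) : Integrable f (digitMeasure b) := by
  obtain ⟨g, hg⟩ := hf.exists_eq_restrict
  refine Integrable.of_bound hf.measurable_digits.aestronglyMeasurable (∑ v, ‖g v‖)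
    (ae_of_all _ fun y => ?_)
  rw [hg]
  exact Finset.single_le_sum (f := fun v => ‖g v‖) (fun _ _ => norm_nonneg _) (Finset.mem_univ _)

theorem integral_digit_eq (m : ℕ) (a : Fin b) :
    ∫ y, (if y m = a then 1 else 0 : ℝ) ∂digitMeasure b = 1 / b := by
  have h1 : ∫ y, (if y m = a then 1 else 0 : ℝ) ∂digitMeasure b =
      ∫ c, (if c = a then 1 else 0 : ℝ) ∂(PMF.uniformOfFintype (Fin b)).toMeasure := by
    rw [← Measure.infinitePi_map_eval (fun _ : ℕ => (PMF.uniformOfFintype (Fin b)).toMeasure) m,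
      integral_map (measurable_pi_apply m).aemeasurable (Measurable.of_discrete.aestronglyMeasurable)]
    rfl
  rw [h1, PMF.integral_eq_sum]
  simp

theorem integral_mul_digit_eq_const {f : (ℕ → Fin b) → ℝ} {m : ℕ} (hf : DependsOn f (Set.Iio m))
    (a : Fin b) :
    ∫ y, f y * (if y m = a then 1 else 0) ∂digitMeasure b =
      1 / b * ∫ y, f y ∂digitMeasure b := by
  obtain ⟨g, hg⟩ := hf.exists_eq_restrict
  have hind : iIndepFun (fun (i : ℕ) (y : ℕ → Fin b) => y i) (digitMeasure b) :=
    iIndepFun_infinitePi (X := fun _ c => c) fun _ => measurable_id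
  have h := hind.indepFun_finset (Finset.range m) {m} (by simp) fun i => by fun_prop
  have := h.integral_fun_comp_mul_comp (f := g)
    (g := fun v : ({m} : Finset ℕ) → Fin b => if v ⟨m, by simp⟩ = a then (1 : ℝ) else 0)
    (Measurable.aemeasurable (by fun_prop)) (Measurable.aemeasurable (by fun_prop))
    Measurable.of_discrete.aestronglyMeasurable
    Measurable.of_discrete.aestronglyMeasurable
  simp only [hg]
  rw [this, integral_digit_eq, mul_comm]

/-- A guess `v` made from the past is right with probability `1 / b`: split according to the value
of `v` and use independence for each constant value. -/
theorem integral_mul_digit_eq {f : (ℕ → Fin b) → ℝ} {v : (ℕ → Fin b) → Fin b} {m : ℕ}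
    (hf : DependsOn f (Set.Iio m)) (hv : DependsOn v (Set.Iio m)) :
    ∫ y, f y * (if y m = v y then 1 else 0) ∂digitMeasure b =
      1 / b * ∫ y, f y ∂digitMeasure b := by
  have hfa : ∀ a, DependsOn (fun y => f y * if v y = a then 1 else 0) (Set.Iio m) := by
    intro a y z h
    simp only [hf h, hv h]
  have hfa' : ∀ a, DependsOn (fun y => (f y * if v y = a then 1 else 0) *
      if y m = a then 1 else 0) (Set.Iio (m + 1)) := by
    intro a y z h
    have h' : ∀ i ∈ Set.Iio m, y i = z i := fun i hi => h i (Nat.lt_succ_of_lt hi)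
    simp only [hf h', hv h', h m (Nat.lt_succ_self m)]
  have h1 : ∀ y, f y * (if y m = v y then 1 else 0) =
      ∑ a, (f y * if v y = a then 1 else 0) * if y m = a then 1 else 0 := by
    intro y
    simp [eq_comm]
  have h2 : ∀ y, f y = ∑ a, f y * if v y = a then 1 else 0 := by
    intro y
    simp
  rw [integral_congr_ae (ae_of_all _ h1), integral_congr_ae (ae_of_all _ h2),
    integral_finsetSum _ fun a _ => (hfa' a).integrable_digits,
    integral_finsetSum _ fun a _ => (hfa a).integrable_digits, Finset.mul_sum]
  exact Finset.sum_congr rfl fun a _ => integral_mul_digit_eq_const (hfa a) a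

/-- The digits of the window are revealed one by one. Since `v t` may use all digits before `n + t`,
including those of the window itself, comparison with an overlapping window is covered. -/
theorem integral_mul_window_eq {f : (ℕ → Fin b) → ℝ} {n : ℕ} (hf : DependsOn f (Set.Iio n))
    {v : ℕ → (ℕ → Fin b) → Fin b} (hv : ∀ t, DependsOn (v t) (Set.Iio (n + t))) (k : ℕ) :
    ∫ y, f y * (if ∀ t < k, y (n + t) = v t y then 1 else 0) ∂digitMeasure b =
      1 / (b : ℝ) ^ k * ∫ y, f y ∂digitMeasure b := by
  induction k with
  | zero => simp
  | succ k ih =>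
    have hdep : DependsOn (fun y => f y * if ∀ t < k, y (n + t) = v t y then 1 else 0)
        (Set.Iio (n + k)) := by
      intro y z h
      have h1 : f y = f z := hf fun i hi => h i (lt_of_lt_of_le hi (Nat.le_add_right n k))
      have h2 : (∀ t < k, y (n + t) = v t y) ↔ ∀ t < k, z (n + t) = v t z := by
        refine forall₂_congr fun t ht => ?_
        rw [h (n + t) (by simpa using ht), hv t fun i hi => h i (by
          simp only [Set.mem_Iio] at hi ⊢; omega)]
      simp only [h1, h2]
    have := integral_mul_digit_eq hdep (hv k)
    rw [ih] at this
    rw [← mul_assoc, show 1 / (b : ℝ) * (1 / (b : ℝ) ^ k) = 1 / (b : ℝ) ^ (k + 1) by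
      rw [pow_succ']; field_simp] at this
    rw [← this]
    refine integral_congr_ae (ae_of_all _ fun y => ?_)
    simp only [Nat.lt_succ_iff_lt_or_eq, or_imp, forall_and, forall_eq]
    split_ifs <;> simp_all

theorem integral_mul_window_const {f : (ℕ → Fin b) → ℝ} {n : ℕ} (hf : DependsOn f (Set.Iio n))
    {k : ℕ} (w : Fin k → Fin b) :
    ∫ y, f y * (if window y k n = w then 1 else 0) ∂digitMeasure b =
      1 / (b : ℝ) ^ k * ∫ y, f y ∂digitMeasure b := by
  rw [← integral_mul_window_eq hf (v := fun t _ => if h : t < k then w ⟨t, h⟩ else 0)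
    (fun t y z _ => rfl) k]
  refine integral_congr_ae (ae_of_all _ fun y => ?_)
  simp only
  congr 2
  rw [window_eq_iff, eq_iff_iff]
  constructor
  · intro h t ht
    simpa [ht] using h ⟨t, ht⟩
  · intro h t
    simpa using h t t.2

theorem integral_window_eq_window {i n : ℕ} (h : i < n) (k : ℕ) :
    ∫ y, (if window y k n = window y k i then 1 else 0 : ℝ) ∂digitMeasure b =
      1 / (b : ℝ) ^ k := by
  have := integral_mul_window_eq (b := b) (f := fun _ => 1) (n := n) (fun y z _ => rfl)
    (v := fun t y => y (i + t)) (fun t y z hyz => hyz _ (by simpa using h)) k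
  simp only [one_mul, integral_const, smul_eq_mul, mul_one, probReal_univ] at this
  rw [← this]
  refine integral_congr_ae (ae_of_all _ fun y => ?_)
  simp only
  congr 1
  rw [window_eq_iff, eq_iff_iff]
  exact ⟨fun h t ht => h ⟨t, ht⟩, fun h t => h t t.2⟩

end RandomDigits

-- One-step recursion for the occurrence statistics

section PoissonRecursion

open MeasureTheory ProbabilityTheory

variable {b : ℕ}

/-- The average over all words of length `k` of a function of the number of occurrences. -/
noncomputable def wordMean (d : ℕ → Fin b) (k : ℕ) (φ : ℕ → ℝ) (n : ℕ) : ℝ :=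
  1 / (b : ℝ) ^ k * ∑ w : Fin k → Fin b, φ (startCount d w n)

/-- The number of recent occurrences of the window read at position `n`. -/
def recentRepeats (y : ℕ → Fin b) (k n : ℕ) : ℝ :=
  ∑ i ∈ Finset.Ico (n - k) n, if window y k n = window y k i then 1 else 0

/-- Only the word read at position `n` changes its count. -/
theorem wordMean_succ (d : ℕ → Fin b) (k : ℕ) (φ : ℕ → ℝ) (n : ℕ) :
    wordMean d k φ (n + 1) = wordMean d k φ n + 1 / (b : ℝ) ^ k *
      (φ (startCount d (window d k n) n + 1) - φ (startCount d (window d k n) n)) := by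
  unfold wordMean
  rw [← mul_add]
  congr 1
  have : ∀ w : Fin k → Fin b, φ (startCount d w (n + 1)) = φ (startCount d w n) +
      if window d k n = w then φ (startCount d w n + 1) - φ (startCount d w n) else 0 := by
    intro w
    rw [startCount_succ]
    split_ifs <;> simp
  simp only [this, Finset.sum_add_distrib, Finset.sum_ite_eq, Finset.mem_univ, if_true]

theorem abs_wordMean_sub_le {φ : ℕ → ℝ} {M : ℝ} (hφ : ∀ s, |φ s| ≤ M) (d : ℕ → Fin b) (k m : ℕ)
    (i : ℕ) : |wordMean d k φ (m + i) - wordMean d k φ m| ≤ 2 * M * (1 / (b : ℝ) ^ k) * i := by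
  induction i with
  | zero => simp
  | succ i ih =>
    rw [← add_assoc, wordMean_succ]
    have h1 := hφ (startCount d (window d k (m + i)) (m + i) + 1)
    have h2 := hφ (startCount d (window d k (m + i)) (m + i))
    have h3 := abs_sub (φ (startCount d (window d k (m + i)) (m + i) + 1))
      (φ (startCount d (window d k (m + i)) (m + i)))
    have h4 : |1 / (b : ℝ) ^ k * (φ (startCount d (window d k (m + i)) (m + i) + 1) -
        φ (startCount d (window d k (m + i)) (m + i)))| ≤ 1 / (b : ℝ) ^ k * (2 * M) := by
      rw [abs_mul, abs_of_nonneg (by positivity : (0 : ℝ) ≤ 1 / (b : ℝ) ^ k)]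
      exact mul_le_mul_of_nonneg_left (by linarith) (by positivity)
    have h5 := abs_add_le (wordMean d k φ (m + i) - wordMean d k φ m)
      (1 / (b : ℝ) ^ k * (φ (startCount d (window d k (m + i)) (m + i) + 1) -
        φ (startCount d (window d k (m + i)) (m + i))))
    rw [add_sub_right_comm]
    push_cast
    linarith

/-- Occurrences starting before `n - k` end before `n`, so this count is independent of the window
at `n`; for `k > n` it vanishes. -/
theorem dependsOn_startCount_sub {k : ℕ} (w : Fin k → Fin b) (n : ℕ) :
    DependsOn (fun d : ℕ → Fin b => startCount d w (n - k)) (Set.Iio n) := by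
  rcases le_total k n with h | h
  · simpa [Nat.sub_add_cancel h] using dependsOn_startCount w (n - k)
  · intro y z _
    simp [Nat.sub_eq_zero_of_le h, startCount]

theorem DependsOn.wordMean_of_startCount {k n m : ℕ} (φ : ℕ → ℝ)
    (h : ∀ w : Fin k → Fin b, DependsOn (fun d : ℕ → Fin b => startCount d w n) (Set.Iio m)) :
    DependsOn (fun d : ℕ → Fin b => wordMean d k φ n) (Set.Iio m) := by
  intro y z hyz
  have : ∀ w : Fin k → Fin b, startCount y w n = startCount z w n := fun w => h w hyz
  simp [wordMean, this]

theorem dependsOn_recentRepeats (k n : ℕ) :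
    DependsOn (fun y : ℕ → Fin b => recentRepeats y k n) (Set.Iio (n + k)) := by
  intro y z h
  refine Finset.sum_congr rfl fun i hi => ?_
  have hi := Finset.mem_Ico.1 hi
  rw [window_congr (d := y) (e := z) fun t ht => h (n + t) (by simp only [Set.mem_Iio]; omega),
    window_congr (d := y) (e := z) fun t ht => h (i + t) (by simp only [Set.mem_Iio]; omega)]

/-- The two counts agree unless the window at `n` repeats one of the last `k` windows; in that case
`recentRepeats` is at least one and the trivial bound suffices. -/
theorem abs_comp_startCount_sub_le {ψ : ℕ → ℝ} {M : ℝ} (hψ : ∀ s, |ψ s| ≤ M) (y : ℕ → Fin b)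
    (k n : ℕ) :
    |ψ (startCount y (window y k n) n) - ψ (startCount y (window y k n) (n - k))| ≤
      2 * M * recentRepeats y k n := by
  have hM : 0 ≤ M := (abs_nonneg _).trans (hψ 0)
  by_cases h : ∃ i ∈ Finset.Ico (n - k) n, window y k n = window y k i
  · obtain ⟨i, hi, hw⟩ := h
    have h1 : 1 ≤ recentRepeats y k n := by
      have := Finset.single_le_sum (s := Finset.Ico (n - k) n)
        (f := fun i => if window y k n = window y k i then (1 : ℝ) else 0)
        (fun i _ => by positivity) hi
      simpa [recentRepeats, hw] using this
    have h2 := abs_sub (ψ (startCount y (window y k n) n))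
      (ψ (startCount y (window y k n) (n - k)))
    have h3 := hψ (startCount y (window y k n) n)
    have h4 := hψ (startCount y (window y k n) (n - k))
    nlinarith
  · push Not at h
    have : startCount y (window y k n) n = startCount y (window y k n) (n - k) := by
      unfold startCount
      congr 1
      ext i
      simp only [Finset.mem_filter, Finset.mem_range]
      constructor
      · rintro ⟨h1, h2⟩
        refine ⟨?_, h2⟩
        by_contra! h3
        exact h i (Finset.mem_Ico.2 ⟨h3, h1⟩) h2.symm
      · rintro ⟨h1, h2⟩
        exact ⟨by omega, h2⟩
    rw [this, sub_self, abs_zero]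
    refine mul_nonneg (by positivity) (Finset.sum_nonneg fun i _ => by positivity)

variable [NeZero b]

theorem abs_wordMean_le {φ : ℕ → ℝ} {M : ℝ} (hφ : ∀ s, |φ s| ≤ M) (d : ℕ → Fin b) (k n : ℕ) :
    |wordMean d k φ n| ≤ M := by
  unfold wordMean
  have hb : (0 : ℝ) < (b : ℝ) ^ k := by
    have := NeZero.pos b
    positivity
  rw [abs_mul, abs_of_nonneg (by positivity), one_div_mul_eq_div, div_le_iff₀ hb]
  refine (Finset.abs_sum_le_sum_abs _ _).trans ((Finset.sum_le_sum fun w _ => hφ _).trans ?_)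
  simp [mul_comm]

/-- Given the digits before `n`, the window at `n` is uniformly distributed over all words, so it
may be averaged out. -/
theorem integral_mul_startCount_window {u : (ℕ → Fin b) → ℝ} {n k : ℕ}
    (hu : DependsOn u (Set.Iio n)) (ψ : ℕ → ℝ) :
    ∫ y, u y * ψ (startCount y (window y k n) (n - k)) ∂digitMeasure b =
      ∫ y, u y * wordMean y k ψ (n - k) ∂digitMeasure b := by
  have hdep : ∀ w : Fin k → Fin b,
      DependsOn (fun y => u y * ψ (startCount y w (n - k))) (Set.Iio n) := by
    intro w y z h
    have h' : startCount y w (n - k) = startCount z w (n - k) := dependsOn_startCount_sub w n h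
    simp only [hu h, h']
  have hdep' : ∀ w : Fin k → Fin b, DependsOn (fun y => (u y * ψ (startCount y w (n - k))) *
      if window y k n = w then 1 else 0) (Set.Iio (n + k)) := by
    intro w y z h
    have h1 : ∀ i ∈ Set.Iio n, y i = z i := fun i hi => h i (lt_of_lt_of_le hi (Nat.le_add_right n k))
    have h2 : window y k n = window z k n :=
      window_congr fun t ht => h _ (by simp only [Set.mem_Iio]; omega)
    have h3 := hdep w h1
    simp only at h3 ⊢
    rw [h2, h3]
  have h1 : ∀ y, u y * ψ (startCount y (window y k n) (n - k)) =
      ∑ w : Fin k → Fin b, (u y * ψ (startCount y w (n - k))) *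
        if window y k n = w then 1 else 0 := by
    intro y
    simp
  have h2 : ∀ y, u y * wordMean y k ψ (n - k) =
      ∑ w : Fin k → Fin b, 1 / (b : ℝ) ^ k * (u y * ψ (startCount y w (n - k))) := by
    intro y
    rw [wordMean, ← Finset.mul_sum, ← Finset.mul_sum]
    ring
  rw [integral_congr_ae (ae_of_all _ h1), integral_congr_ae (ae_of_all _ h2),
    integral_finsetSum _ fun w _ => (hdep' w).integrable_digits,
    integral_finsetSum _ fun w _ => (hdep w).integrable_digits.const_mul _]
  refine Finset.sum_congr rfl fun w _ => ?_
  rw [integral_mul_window_const (hdep w), integral_const_mul]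

theorem integral_recentRepeats_le (k n : ℕ) :
    ∫ y, recentRepeats y k n ∂digitMeasure b ≤ k * (1 / (b : ℝ) ^ k) := by
  unfold recentRepeats
  rw [integral_finsetSum]
  · rw [Finset.sum_congr rfl fun i hi => integral_window_eq_window (Finset.mem_Ico.1 hi).2 k,
      Finset.sum_const, nsmul_eq_mul, Nat.card_Ico]
    refine mul_le_mul_of_nonneg_right (Nat.cast_le.2 (by omega)) (by positivity)
  · intro i hi
    have hi := Finset.mem_Ico.1 hi
    refine DependsOn.integrable_digits (m := n + k) fun y z h => ?_
    rw [window_congr (d := y) (e := z) fun t ht => h (n + t) (by simp only [Set.mem_Iio]; omega),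
      window_congr (d := y) (e := z) fun t ht => h (i + t) (by simp only [Set.mem_Iio]; omega)]

/-- Reading one more digit changes the second moment of the deviation of `wordMean φ` from a
constant, up to a quadratic error, by the correlation with the discrete derivative of `φ`. -/
theorem integral_wordMean_succ_sq_le {φ ψ : ℕ → ℝ} (hφ : ∀ s, |φ s| ≤ 1)
    (hψ : ∀ s, ψ s = φ (s + 1) - φ s) {c e : ℝ} (hc : |c| ≤ 1) (he : |e| ≤ 2) (k n : ℕ) :
    ∫ y, (wordMean y k φ (n + 1) - c - 1 / (b : ℝ) ^ k * e) ^ 2 ∂digitMeasure b ≤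
      ∫ y, (wordMean y k φ n - c) ^ 2 ∂digitMeasure b +
      2 * (1 / (b : ℝ) ^ k) *
        ∫ y, (wordMean y k φ n - c) * (wordMean y k ψ n - e) ∂digitMeasure b +
      64 * (k + 1) * (1 / (b : ℝ) ^ k) ^ 2 := by
  set q : ℝ := 1 / (b : ℝ) ^ k with hq
  have hq0 : 0 ≤ q := by positivity
  have hψ2 : ∀ s, |ψ s| ≤ 2 := fun s => by
    rw [hψ]
    have := abs_sub (φ (s + 1)) (φ s)
    linarith [hφ (s + 1), hφ s]
  have hS : ∀ m, m ≤ n + 1 → ∀ w : Fin k → Fin b,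
      DependsOn (fun d : ℕ → Fin b => startCount d w m) (Set.Iio (n + 1 + k)) := by
    intro m hm w y z h
    exact dependsOn_startCount w m fun i hi => h i (by simp only [Set.mem_Iio] at hi ⊢; omega)
  have hZ : ∀ m, m ≤ n + 1 → ∀ χ : ℕ → ℝ,
      DependsOn (fun d : ℕ → Fin b => wordMean d k χ m) (Set.Iio (n + 1 + k)) :=
    fun m hm χ => DependsOn.wordMean_of_startCount χ (hS m hm)
  have hwin : DependsOn (fun d : ℕ → Fin b => window d k n) (Set.Iio (n + 1 + k)) := by
    intro y z h
    exact window_congr fun t ht => h _ (by simp only [Set.mem_Iio]; omega)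
  have hR : DependsOn (fun y : ℕ → Fin b => recentRepeats y k n) (Set.Iio (n + 1 + k)) := by
    intro y z h
    exact dependsOn_recentRepeats k n fun i hi => h i (by simp only [Set.mem_Iio] at hi ⊢; omega)
  have hW : ∀ m, m ≤ n + 1 →
      DependsOn (fun y : ℕ → Fin b => ψ (startCount y (window y k n) m)) (Set.Iio (n + 1 + k)) := by
    intro m hm y z h
    have h1 := hwin h
    have h2 := hS m hm (window y k n) h
    simp only at h1 h2 ⊢
    rw [h2, h1]
  have hn0 : n - k ≤ n + 1 := by omega
  have hn1 : n ≤ n + 1 := by omega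
  have i1 : Integrable (fun y => (wordMean y k φ n - c) ^ 2) (digitMeasure b) :=
    DependsOn.integrable_digits (m := n + 1 + k) fun y z h => by
      have h1 := hZ n hn1 φ h
      simp only at h1 ⊢
      rw [h1]
  have i2 : Integrable (fun y => (wordMean y k φ n - c) * (wordMean y k ψ n - e))
      (digitMeasure b) :=
    DependsOn.integrable_digits (m := n + 1 + k) fun y z h => by
      have h1 := hZ n hn1 φ h
      have h2 := hZ n hn1 ψ h
      simp only at h1 h2 ⊢
      rw [h1, h2]
  have i3 : Integrable (fun y => (wordMean y k φ (n - k) - c) *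
      ψ (startCount y (window y k n) (n - k))) (digitMeasure b) :=
    DependsOn.integrable_digits (m := n + 1 + k) fun y z h => by
      have h1 := hZ _ hn0 φ h
      have h2 := hW _ hn0 h
      simp only at h1 h2 ⊢
      rw [h1, h2]
  have i4 : Integrable (fun y => (wordMean y k φ (n - k) - c) * wordMean y k ψ (n - k))
      (digitMeasure b) :=
    DependsOn.integrable_digits (m := n + 1 + k) fun y z h => by
      have h1 := hZ _ hn0 φ h
      have h2 := hZ _ hn0 ψ h
      simp only at h1 h2 ⊢
      rw [h1, h2]
  have i5 : Integrable (fun y => recentRepeats y k n) (digitMeasure b) := hR.integrable_digits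
  have i6 : Integrable (fun y => (wordMean y k φ (n + 1) - c - q * e) ^ 2) (digitMeasure b) :=
    DependsOn.integrable_digits (m := n + 1 + k) fun y z h => by
      have h1 := hZ _ le_rfl φ h
      simp only at h1 ⊢
      rw [h1]
  have hdiff : ∀ {χ : ℕ → ℝ} {M : ℝ}, (∀ s, |χ s| ≤ M) → ∀ y : ℕ → Fin b,
      |wordMean y k χ n - wordMean y k χ (n - k)| ≤ 2 * M * q * k := by
    intro χ M hχ y
    have hM : 0 ≤ M := (abs_nonneg _).trans (hχ 0)
    have h := abs_wordMean_sub_le hχ y k (n - k) (n - (n - k))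
    rw [show n - k + (n - (n - k)) = n by omega] at h
    refine h.trans (mul_le_mul_of_nonneg_left (Nat.cast_le.2 (by omega)) (by positivity))
  -- The square is expanded, and in the cross term the values at `n` are traded for values at `n -
  -- k`. The two resulting terms stand on opposite sides and have equal integrals by
  -- `integral_mul_startCount_window`.
  have hp1 : ∀ y : ℕ → Fin b, (wordMean y k φ (n + 1) - c - q * e) ^ 2 +
      2 * q * ((wordMean y k φ (n - k) - c) * wordMean y k ψ (n - k)) ≤
      (wordMean y k φ n - c) ^ 2 + 2 * q *
      ((wordMean y k φ n - c) * (wordMean y k ψ n - e) +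
        (wordMean y k φ (n - k) - c) * ψ (startCount y (window y k n) (n - k)) +
        (16 * q * k + 8 * recentRepeats y k n)) + 16 * q ^ 2 := by
    intro y
    have e1 := hdiff hφ y
    have e2 := hdiff hψ2 y
    have e3 := abs_comp_startCount_sub_le hψ2 y k n
    have e4 := abs_wordMean_le hφ y k n
    have e5 := abs_wordMean_le hφ y k (n - k)
    have e6 := abs_wordMean_le hψ2 y k (n - k)
    have e7 := hψ2 (startCount y (window y k n) n)
    rw [wordMean_succ, ← hψ]
    set u := wordMean y k φ n
    set u' := wordMean y k φ (n - k)
    set v := wordMean y k ψ n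
    set v' := wordMean y k ψ (n - k)
    set s := ψ (startCount y (window y k n) n)
    set s' := ψ (startCount y (window y k n) (n - k))
    set R := recentRepeats y k n
    have a1 : |u - c| ≤ 2 := (abs_sub _ _).trans (by linarith)
    have a2 : |u' - c| ≤ 2 := (abs_sub _ _).trans (by linarith)
    have a3 : |s - e| ≤ 4 := (abs_sub _ _).trans (by linarith)
    have hqk : 0 ≤ q * k := by positivity
    have b1 : (u - u') * s ≤ (2 * 1 * q * k) * 2 := by
      refine (le_abs_self _).trans ?_
      rw [abs_mul]
      exact mul_le_mul e1 e7 (abs_nonneg _) (by linarith)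
    have b2 : (u' - c) * (s - s') ≤ 2 * (2 * 2 * R) := by
      refine (le_abs_self _).trans ?_
      rw [abs_mul]
      exact mul_le_mul a2 e3 (abs_nonneg _) (by norm_num)
    have b3 : -((u - u') * v') ≤ (2 * 1 * q * k) * 2 := by
      refine (neg_le_abs _).trans ?_
      rw [abs_mul]
      exact mul_le_mul e1 e6 (abs_nonneg _) (by linarith)
    have b4 : -((u - c) * (v - v')) ≤ 2 * (2 * 2 * q * k) := by
      refine (neg_le_abs _).trans ?_
      rw [abs_mul]
      exact mul_le_mul a1 e2 (abs_nonneg _) (by norm_num)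
    have b5 : (s - e) ^ 2 ≤ 16 := by
      rw [← sq_abs]
      nlinarith [abs_nonneg (s - e)]
    have b6 : q ^ 2 * (s - e) ^ 2 ≤ q ^ 2 * 16 := mul_le_mul_of_nonneg_left b5 (sq_nonneg q)
    have b7 : (u - c) * s + (u' - c) * v' ≤ (u - c) * v + (u' - c) * s' +
        (16 * q * k + 8 * R) := by linarith
    have b8 := mul_le_mul_of_nonneg_left b7 (by positivity : 0 ≤ 2 * q)
    nlinarith
  have i7 : Integrable (fun y => (wordMean y k φ n - c) * (wordMean y k ψ n - e) +
      (wordMean y k φ (n - k) - c) * ψ (startCount y (window y k n) (n - k))) (digitMeasure b) :=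
    i2.add i3
  have i8 : Integrable (fun y => 16 * q * k + 8 * recentRepeats y k n) (digitMeasure b) :=
    (integrable_const _).add (i5.const_mul 8)
  have i9 : Integrable (fun y => 2 * q * ((wordMean y k φ n - c) * (wordMean y k ψ n - e) +
      (wordMean y k φ (n - k) - c) * ψ (startCount y (window y k n) (n - k)) +
      (16 * q * k + 8 * recentRepeats y k n))) (digitMeasure b) := (i7.add i8).const_mul _
  have i10 : Integrable (fun y => (wordMean y k φ n - c) ^ 2 +
      2 * q * ((wordMean y k φ n - c) * (wordMean y k ψ n - e) +
      (wordMean y k φ (n - k) - c) * ψ (startCount y (window y k n) (n - k)) +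
      (16 * q * k + 8 * recentRepeats y k n))) (digitMeasure b) := i1.add i9
  have hint := integral_mono (i6.add (i4.const_mul (2 * q)))
    (i10.add (integrable_const (16 * q ^ 2))) hp1
  have hu : DependsOn (fun y : ℕ → Fin b => wordMean y k φ (n - k) - c) (Set.Iio n) := by
    intro y z h
    have := DependsOn.wordMean_of_startCount φ (fun w : Fin k → Fin b =>
      dependsOn_startCount_sub w n) h
    simp only at this ⊢
    rw [this]
  have hkey := integral_mul_startCount_window (k := k) hu ψ
  simp only [Pi.add_apply] at hint
  rw [integral_add i6 (i4.const_mul _), integral_add i10 (integrable_const _), integral_add i1 i9,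
    integral_const_mul, integral_const_mul, integral_add i7 i8, integral_add i2 i3,
    integral_add (integrable_const _) (i5.const_mul 8), integral_const_mul _ (fun y => recentRepeats y k n),
    hkey] at hint
  simp only [integral_const, smul_eq_mul, probReal_univ, one_mul] at hint
  have hrr := integral_recentRepeats_le (b := b) k n
  rw [← hq] at hrr
  have := mul_le_mul_of_nonneg_left hrr hq0
  have hkq : 0 ≤ q ^ 2 * k := by positivity
  -- The errors are `2 * q * (16 * q * k + 8 * (k * q)) + 16 * q ^ 2`, which is at most `64 * (k +
  -- 1) * q ^ 2`.
  nlinarith [sq_nonneg q]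

end PoissonRecursion

/-! ### Poisson probabilities -/

section PoissonProbabilities

/-- The Poisson probability of the value `j` for the parameter `x`. -/
noncomputable def poissonProb (j : ℕ) (x : ℝ) : ℝ := Real.exp (-x) * x ^ j / (j.factorial : ℝ)

/-- The derivative of `poissonProb j`. -/
noncomputable def poissonProbDeriv : ℕ → ℝ → ℝ
  | 0, x => -poissonProb 0 x
  | j + 1, x => poissonProb j x - poissonProb (j + 1) x

theorem hasDerivAt_poissonProb (j : ℕ) (x : ℝ) :
    HasDerivAt (poissonProb j) (poissonProbDeriv j x) x := by
  have h1 : HasDerivAt (fun x : ℝ => Real.exp (-x)) (-Real.exp (-x)) x := by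
    simpa using (hasDerivAt_neg x).exp
  have h := (h1.mul (hasDerivAt_pow j x)).div_const (j.factorial : ℝ)
  refine h.congr_deriv ?_
  cases j with
  | zero => simp [poissonProbDeriv, poissonProb]
  | succ j =>
    have : (j.factorial : ℝ) ≠ 0 := by positivity
    simp only [poissonProbDeriv, poissonProb, Nat.factorial_succ]
    push_cast
    field_simp
    ring

theorem poissonProb_nonneg (j : ℕ) {x : ℝ} (hx : 0 ≤ x) : 0 ≤ poissonProb j x := by
  unfold poissonProb
  positivity

theorem poissonProb_le_one (j : ℕ) {x : ℝ} (hx : 0 ≤ x) : poissonProb j x ≤ 1 := by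
  unfold poissonProb
  rw [mul_div_assoc, Real.exp_neg, inv_mul_le_one₀ (Real.exp_pos x)]
  exact Real.pow_div_factorial_le_exp x hx j

theorem abs_poissonProbDeriv_le (j : ℕ) {x : ℝ} (hx : 0 ≤ x) : |poissonProbDeriv j x| ≤ 1 := by
  cases j with
  | zero =>
    have := poissonProb_nonneg 0 hx
    have := poissonProb_le_one 0 hx
    rw [poissonProbDeriv, abs_neg, abs_of_nonneg (by assumption)]
    assumption
  | succ j =>
    have := poissonProb_nonneg j hx
    have := poissonProb_le_one j hx
    have := poissonProb_nonneg (j + 1) hx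
    have := poissonProb_le_one (j + 1) hx
    rw [poissonProbDeriv, abs_le]
    constructor <;> linarith

theorem abs_poissonProb_sub_le (j : ℕ) {x y : ℝ} (hx : 0 ≤ x) (hy : 0 ≤ y) :
    |poissonProb j y - poissonProb j x| ≤ |y - x| := by
  have := (convex_Ici (0 : ℝ)).norm_image_sub_le_of_norm_hasDerivWithin_le
    (fun z _ => (hasDerivAt_poissonProb j z).hasDerivWithinAt)
    (fun z hz => abs_poissonProbDeriv_le j hz) hx hy
  simpa using this

theorem abs_poissonProbDeriv_sub_le (j : ℕ) {x y : ℝ} (hx : 0 ≤ x) (hy : 0 ≤ y) :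
    |poissonProbDeriv j y - poissonProbDeriv j x| ≤ 2 * |y - x| := by
  cases j with
  | zero =>
    have h := abs_poissonProb_sub_le 0 hx hy
    have h0 := abs_nonneg (y - x)
    rw [poissonProbDeriv, poissonProbDeriv,
      show -poissonProb 0 y - -poissonProb 0 x = -(poissonProb 0 y - poissonProb 0 x) by ring,
      abs_neg]
    linarith
  | succ j =>
    have h1 := abs_poissonProb_sub_le j hx hy
    have h2 := abs_poissonProb_sub_le (j + 1) hx hy
    have h3 := abs_sub (poissonProb j y - poissonProb j x)
      (poissonProb (j + 1) y - poissonProb (j + 1) x)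
    rw [poissonProbDeriv, poissonProbDeriv, show poissonProb j y - poissonProb (j + 1) y -
      (poissonProb j x - poissonProb (j + 1) x) = (poissonProb j y - poissonProb j x) -
        (poissonProb (j + 1) y - poissonProb (j + 1) x) by ring]
    linarith

/-- Mean value inequality for `poissonProb j t - t * poissonProbDeriv j x`, whose derivative is at
most `2 * q` on the interval. -/
theorem abs_poissonProb_taylor_le (j : ℕ) {x q : ℝ} (hx : 0 ≤ x) (hq : 0 ≤ q) :
    |poissonProb j (x + q) - poissonProb j x - q * poissonProbDeriv j x| ≤ 2 * q ^ 2 := by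
  have := (convex_Icc x (x + q)).norm_image_sub_le_of_norm_hasDerivWithin_le (C := 2 * q)
    (f := fun t => poissonProb j t - t * poissonProbDeriv j x)
    (f' := fun t => poissonProbDeriv j t - 1 * poissonProbDeriv j x)
    (fun z _ => ((hasDerivAt_poissonProb j z).sub
      ((hasDerivAt_id z).mul_const _)).hasDerivWithinAt)
    (fun z hz => by
      rw [one_mul, Real.norm_eq_abs]
      refine (abs_poissonProbDeriv_sub_le j hx (hx.trans hz.1)).trans ?_
      rw [abs_of_nonneg (by linarith [hz.1])]
      linarith [hz.2])
    (Set.left_mem_Icc.2 (by linarith)) (Set.right_mem_Icc.2 (by linarith))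
  rw [add_sub_cancel_left, Real.norm_eq_abs, Real.norm_eq_abs, abs_of_nonneg hq] at this
  refine (le_of_eq ?_).trans (this.trans (le_of_eq (by ring)))
  congr 1
  ring

end PoissonProbabilities

-- Almost every sequence is Poisson generic

section AlmostSure

open MeasureTheory ProbabilityTheory

/-- The series of the squares has finite integral, so it converges almost everywhere and its terms
tend to zero. -/
theorem ae_tendsto_zero_of_summable_integral_sq {Ω : Type*} [MeasurableSpace Ω] {μ : Measure Ω}
    {f : ℕ → Ω → ℝ} {c : ℕ → ℝ} (hf : ∀ k, Measurable (f k))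
    (hint : ∀ k, Integrable (fun y => f k y ^ 2) μ) (hc : Summable c)
    (h : ∀ k, ∫ y, f k y ^ 2 ∂μ ≤ c k) : ∀ᵐ y ∂μ, Tendsto (fun k => f k y) atTop (𝓝 0) := by
  have hc0 : ∀ k, 0 ≤ c k := fun k => (integral_nonneg fun y => sq_nonneg _).trans (h k)
  have hm : ∀ k, Measurable fun y => ENNReal.ofReal (f k y ^ 2) := fun k => by
    have := hf k
    fun_prop
  have hfin : ∫⁻ y, ∑' k, ENNReal.ofReal (f k y ^ 2) ∂μ ≠ ⊤ := by
    rw [lintegral_tsum fun k => (hm k).aemeasurable]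
    refine ne_top_of_le_ne_top (b := ∑' k, ENNReal.ofReal (c k)) ?_ (ENNReal.tsum_le_tsum fun k => ?_)
    · rw [← ENNReal.ofReal_tsum_of_nonneg hc0 hc]
      exact ENNReal.ofReal_ne_top
    · rw [← ofReal_integral_eq_lintegral_ofReal (hint k) (ae_of_all _ fun y => sq_nonneg _)]
      exact ENNReal.ofReal_le_ofReal (h k)
  filter_upwards [ae_lt_top (Measurable.tsum hm) hfin] with y hy
  have h0 := ENNReal.tendsto_atTop_zero_of_tsum_ne_top hy.ne
  have h1 : Tendsto (fun k => f k y ^ 2) atTop (𝓝 0) := by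
    have := (ENNReal.tendsto_toReal ENNReal.zero_ne_top).comp h0
    simpa [Function.comp_def, ENNReal.toReal_ofReal (sq_nonneg _)] using this
  have h2 := (Real.continuous_sqrt.tendsto 0).comp h1
  simp only [Function.comp_def, Real.sqrt_sq_eq_abs, Real.sqrt_zero] at h2
  exact tendsto_zero_iff_abs_tendsto_zero _ |>.2 h2

variable {b : ℕ} [NeZero b]

/-- The indicator of the value `j`. -/
def indicatorOf (j s : ℕ) : ℝ := if s = j then 1 else 0

theorem abs_indicatorOf_le (j s : ℕ) : |indicatorOf j s| ≤ 1 := by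
  unfold indicatorOf
  split_ifs <;> simp

theorem wordRatio_eq_wordMean {b : ℕ} (d : ℕ → Fin b) (k j n : ℕ) :
    wordRatio d k j n = wordMean d k (indicatorOf j) n := by
  simp [wordRatio, wordMean, indicatorOf]

theorem wordMean_sub {b : ℕ} (d : ℕ → Fin b) (k : ℕ) (φ χ : ℕ → ℝ) (n : ℕ) :
    wordMean d k (fun s => φ s - χ s) n = wordMean d k φ n - wordMean d k χ n := by
  simp [wordMean, Finset.sum_sub_distrib, mul_sub]

theorem wordMean_neg {b : ℕ} (d : ℕ → Fin b) (k : ℕ) (φ : ℕ → ℝ) (n : ℕ) :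
    wordMean d k (fun s => -φ s) n = -wordMean d k φ n := by
  simp [wordMean]

theorem integrable_wordMean_sub_sq (k n : ℕ) (φ : ℕ → ℝ) (c : ℝ) :
    Integrable (fun y => (wordMean y k φ n - c) ^ 2) (digitMeasure b) :=
  DependsOn.integrable_digits (m := n + k) fun y z h => by
    have := DependsOn.wordMean_of_startCount φ (fun w : Fin k → Fin b => dependsOn_startCount w n) h
    simp only at this ⊢
    rw [this]

/-- The mean square distance between the empirical and the Poisson probability of `j`. -/
noncomputable def poissonVariance (b : ℕ) [NeZero b] (k j n : ℕ) : ℝ :=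
  ∫ y, (wordMean y k (indicatorOf j) n - poissonProb j (n * (1 / (b : ℝ) ^ k))) ^ 2
    ∂digitMeasure b

/-- `integral_wordMean_succ_sq_le` with the linear approximation of the Poisson probability replaced
by its true next value; the Taylor error raises the constant from 64 to 84. -/
theorem poissonVariance_succ_le (k j n : ℕ) :
    poissonVariance b k j (n + 1) ≤
      poissonVariance b k j n + 2 * (1 / (b : ℝ) ^ k) *
        ∫ y, (wordMean y k (indicatorOf j) n - poissonProb j (n * (1 / (b : ℝ) ^ k))) *
          (wordMean y k (fun s => indicatorOf j (s + 1) - indicatorOf j s) n -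
            poissonProbDeriv j (n * (1 / (b : ℝ) ^ k))) ∂digitMeasure b +
      84 * (k + 1) * (1 / (b : ℝ) ^ k) ^ 2 := by
  unfold poissonVariance
  have hq1 : 1 / (b : ℝ) ^ k ≤ 1 := by
    have : (1 : ℝ) ≤ b := by exact_mod_cast NeZero.one_le
    exact div_le_one_of_le₀ (one_le_pow₀ this) (by positivity)
  set q : ℝ := 1 / (b : ℝ) ^ k with hq
  have hq0 : 0 ≤ q := by positivity
  have hnq : 0 ≤ n * q := by positivity
  have hc : |poissonProb j (n * q)| ≤ 1 := by
    rw [abs_of_nonneg (poissonProb_nonneg j hnq)]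
    exact poissonProb_le_one j hnq
  have he := abs_poissonProbDeriv_le j hnq
  have hstep := integral_wordMean_succ_sq_le (b := b) (abs_indicatorOf_le j) (fun s => rfl) hc
    (he.trans one_le_two) k n
  rw [← hq] at hstep
  have htay := abs_poissonProb_taylor_le j hnq hq0
  rw [show n * q + q = ((n + 1 : ℕ) : ℝ) * q by push_cast; ring] at htay
  set c := poissonProb j (n * q)
  set e := poissonProbDeriv j (n * q)
  set c' := poissonProb j (((n + 1 : ℕ) : ℝ) * q)
  have hpt : ∀ y : ℕ → Fin b, (wordMean y k (indicatorOf j) (n + 1) - c') ^ 2 ≤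
      (wordMean y k (indicatorOf j) (n + 1) - c - q * e) ^ 2 + 20 * q ^ 2 := by
    intro y
    have h1 := abs_wordMean_le (abs_indicatorOf_le j) y k (n + 1)
    set Z := wordMean y k (indicatorOf j) (n + 1)
    set r := c' - c - q * e
    rw [show Z - c' = (Z - c - q * e) - r by simp only [r]; ring]
    have hqe : |q * e| ≤ 1 := by
      rw [abs_mul, abs_of_nonneg hq0]
      nlinarith [abs_nonneg e]
    have h2 : |Z - c - q * e| ≤ 3 := by
      have := abs_sub (Z - c) (q * e)
      have := abs_sub Z c
      linarith
    have h3 : -((Z - c - q * e) * r) ≤ 3 * (2 * q ^ 2) := by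
      refine (neg_le_abs _).trans ?_
      rw [abs_mul]
      exact mul_le_mul h2 htay (abs_nonneg _) (by norm_num)
    have h4 : r ^ 2 ≤ (2 * q ^ 2) ^ 2 := by
      rw [← sq_abs]
      exact pow_le_pow_left₀ (abs_nonneg _) htay 2
    have h5 : q ^ 2 * q ^ 2 ≤ q ^ 2 * 1 :=
      mul_le_mul_of_nonneg_left (pow_le_one₀ hq0 hq1) (sq_nonneg q)
    nlinarith
  have i1 : Integrable (fun y => (wordMean y k (indicatorOf j) (n + 1) - c - q * e) ^ 2)
      (digitMeasure b) := by
    simpa only [sub_sub] using integrable_wordMean_sub_sq k (n + 1) (indicatorOf j) (c + q * e)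
  have hint := integral_mono (integrable_wordMean_sub_sq k (n + 1) (indicatorOf j) c')
    (i1.add (integrable_const (20 * q ^ 2))) hpt
  simp only [Pi.add_apply] at hint
  rw [integral_add i1 (integrable_const _)] at hint
  simp only [integral_const, smul_eq_mul, probReal_univ, one_mul] at hint
  have hk : 0 ≤ (k : ℝ) * q ^ 2 := by positivity
  linarith

/-- With `q = 1 / b ^ k`, the variance for `j + 1` at `n + 1` is at most `1 - q` times its old value
plus `q` times that for `j`, plus an error of order `(k + 1) * q ^ 2`. This is a convex combination,
so a bound common to all `j` grows only by the error. The start at `n = 0` is exact. -/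
theorem poissonVariance_le (k j n : ℕ) :
    poissonVariance b k j n ≤ 84 * (k + 1) * (1 / (b : ℝ) ^ k) ^ 2 * n := by
  have hq1 : 1 / (b : ℝ) ^ k ≤ 1 := by
    have : (1 : ℝ) ≤ b := by exact_mod_cast NeZero.one_le
    exact div_le_one_of_le₀ (one_le_pow₀ this) (by positivity)
  have hq0 : 0 ≤ 1 / (b : ℝ) ^ k := by positivity
  have hnn : ∀ j n, 0 ≤ poissonVariance b k j n := fun j n => integral_nonneg fun y => sq_nonneg _
  induction n generalizing j with
  | zero =>
    have hbk : (b : ℝ) ^ k ≠ 0 := by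
      have := NeZero.ne b
      positivity
    have : poissonVariance b k j 0 = 0 := by
      cases j with
      | zero => simp [poissonVariance, wordMean, startCount, indicatorOf, poissonProb, hbk]
      | succ j => simp [poissonVariance, wordMean, startCount, indicatorOf, poissonProb]
    simp [this]
  | succ n ih =>
    have hstep := poissonVariance_succ_le (b := b) k j n
    have ihj := ih j
    have hj := hnn j n
    push_cast
    cases j with
    | zero =>
      have h1 : ∀ s, indicatorOf 0 (s + 1) - indicatorOf 0 s = -indicatorOf 0 s := fun s => by
        simp [indicatorOf]
      have h2 : ∀ y : ℕ → Fin b,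
          (wordMean y k (indicatorOf 0) n - poissonProb 0 (n * (1 / (b : ℝ) ^ k))) *
          (wordMean y k (fun s => indicatorOf 0 (s + 1) - indicatorOf 0 s) n -
            poissonProbDeriv 0 (n * (1 / (b : ℝ) ^ k))) =
          -(wordMean y k (indicatorOf 0) n - poissonProb 0 (n * (1 / (b : ℝ) ^ k))) ^ 2 := by
        intro y
        simp only [h1, wordMean_neg, poissonProbDeriv]
        ring
      rw [integral_congr_ae (ae_of_all _ h2), integral_neg] at hstep
      change _ ≤ _ + 2 * _ * -poissonVariance b k 0 n + _ at hstep
      nlinarith [mul_nonneg hq0 hj]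
    | succ j =>
      have h1 : ∀ s, indicatorOf (j + 1) (s + 1) - indicatorOf (j + 1) s =
          indicatorOf j s - indicatorOf (j + 1) s := fun s => by
        simp [indicatorOf]
      -- With deviations `α` for `j` and `β` for `j + 1`, this is `β * (α - β) ≤ (α ^ 2 - β ^ 2) /
      -- 2`.
      have h2 : ∀ y : ℕ → Fin b,
          (wordMean y k (indicatorOf (j + 1)) n - poissonProb (j + 1) (n * (1 / (b : ℝ) ^ k))) *
          (wordMean y k (fun s => indicatorOf (j + 1) (s + 1) - indicatorOf (j + 1) s) n -
            poissonProbDeriv (j + 1) (n * (1 / (b : ℝ) ^ k))) ≤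
          (1 / 2) * (wordMean y k (indicatorOf j) n - poissonProb j (n * (1 / (b : ℝ) ^ k))) ^ 2 -
          (1 / 2) * (wordMean y k (indicatorOf (j + 1)) n -
            poissonProb (j + 1) (n * (1 / (b : ℝ) ^ k))) ^ 2 := by
        intro y
        simp only [h1, wordMean_sub, poissonProbDeriv]
        set u := wordMean y k (indicatorOf j) n
        set v := wordMean y k (indicatorOf (j + 1)) n
        set p := poissonProb j (n * (1 / (b : ℝ) ^ k))
        set p' := poissonProb (j + 1) (n * (1 / (b : ℝ) ^ k))
        nlinarith [sq_nonneg ((u - p) - (v - p'))]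
      have i1 := (integrable_wordMean_sub_sq (b := b) k n (indicatorOf j)
        (poissonProb j (n * (1 / (b : ℝ) ^ k)))).const_mul (1 / 2)
      have i2 := (integrable_wordMean_sub_sq (b := b) k n (indicatorOf (j + 1))
        (poissonProb (j + 1) (n * (1 / (b : ℝ) ^ k)))).const_mul (1 / 2)
      have i3 : Integrable (fun y => (wordMean y k (indicatorOf (j + 1)) n -
          poissonProb (j + 1) (n * (1 / (b : ℝ) ^ k))) *
          (wordMean y k (fun s => indicatorOf (j + 1) (s + 1) - indicatorOf (j + 1) s) n -
            poissonProbDeriv (j + 1) (n * (1 / (b : ℝ) ^ k)))) (digitMeasure b) :=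
        DependsOn.integrable_digits (m := n + k) fun y z h => by
          have h1 := DependsOn.wordMean_of_startCount (indicatorOf (j + 1))
            (fun w : Fin k → Fin b => dependsOn_startCount w n) h
          have h2 := DependsOn.wordMean_of_startCount
            (fun s => indicatorOf (j + 1) (s + 1) - indicatorOf (j + 1) s)
            (fun w : Fin k → Fin b => dependsOn_startCount w n) h
          simp only at h1 h2 ⊢
          rw [h1, h2]
      have hint := integral_mono i3 (i1.sub i2) h2
      simp only [Pi.sub_apply] at hint
      rw [integral_sub i1 i2, integral_const_mul, integral_const_mul] at hint
      change _ ≤ 1 / 2 * poissonVariance b k j n - 1 / 2 * poissonVariance b k (j + 1) n at hint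
      have h3 := mul_le_mul_of_nonneg_left hint hq0
      have h4 := mul_le_mul_of_nonneg_left (ih j) hq0
      have h5 := mul_le_mul_of_nonneg_left ihj (sub_nonneg.2 hq1)
      nlinarith

theorem ae_isPoissonGenericSeq (hb : 2 ≤ b) :
    ∀ᵐ y ∂digitMeasure b, IsPoissonGenericSeq y := by
  have key : ∀ p : {l : ℚ // 0 < l} × ℕ, ∀ᵐ y ∂digitMeasure b,
      Tendsto (fun k : ℕ => poissonCount (p.1 : ℝ) p.2 k y) atTop
        (𝓝 (poissonProb p.2 p.1)) := by
    rintro ⟨⟨l, hl⟩, j⟩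
    have hl' : (0 : ℝ) < l := by exact_mod_cast hl
    have hb1 : (1 : ℝ) < b := by exact_mod_cast hb
    have hbk : ∀ k : ℕ, (0 : ℝ) < (b : ℝ) ^ k := fun k => by positivity
    let N : ℕ → ℕ := fun k => ⌊(l : ℝ) * (b : ℝ) ^ k⌋₊ + 1
    have hN1 : ∀ k, (l : ℝ) * (b : ℝ) ^ k ≤ N k := fun k => by
      simpa [N] using (Nat.lt_floor_add_one _).le
    have hN2 : ∀ k, (N k : ℝ) ≤ l * (b : ℝ) ^ k + 1 := fun k => by
      simpa [N] using Nat.floor_le (by positivity)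
    have hbinv : Tendsto (fun k : ℕ => 1 / (b : ℝ) ^ k) atTop (𝓝 0) := by
      simpa [← inv_pow] using tendsto_pow_atTop_nhds_zero_of_lt_one (by positivity)
        (inv_lt_one_of_one_lt₀ hb1)
    have hlim : Tendsto (fun k : ℕ => (N k : ℝ) * (1 / (b : ℝ) ^ k)) atTop (𝓝 l) := by
      refine tendsto_of_tendsto_of_tendsto_of_le_of_le tendsto_const_nhds
        (by simpa using (tendsto_const_nhds (x := (l : ℝ))).add hbinv) (fun k => ?_) fun k => ?_
      · rw [mul_one_div, le_div_iff₀ (hbk k)]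
        exact hN1 k
      · simp only
        rw [mul_one_div, div_le_iff₀ (hbk k), add_mul, inv_mul_cancel₀ (hbk k).ne']
        exact hN2 k
    have hprob : Tendsto (fun k : ℕ => poissonProb j ((N k : ℝ) * (1 / (b : ℝ) ^ k))) atTop
        (𝓝 (poissonProb j l)) :=
      ((hasDerivAt_poissonProb j l).continuousAt.tendsto).comp hlim
    -- This is the variance bound after inserting `N k ≤ (l + 1) * b ^ k`, which cancels one of the
    -- two factors `1 / b ^ k`.
    have hsum : Summable fun k : ℕ => 84 * (l + 1) * (((k : ℝ) ^ 1 + 1) * (1 / (b : ℝ)) ^ k) := by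
      refine Summable.mul_left _ ?_
      have hr : ‖1 / (b : ℝ)‖ < 1 := by
        rw [Real.norm_of_nonneg (by positivity)]
        exact (div_lt_one (by linarith)).2 hb1
      simp only [add_mul, one_mul]
      exact (summable_pow_mul_geometric_of_norm_lt_one 1 hr).add
        (summable_geometric_of_norm_lt_one hr)
    have hae := ae_tendsto_zero_of_summable_integral_sq (μ := digitMeasure b)
      (f := fun k y => wordMean y k (indicatorOf j) (N k) -
        poissonProb j ((N k : ℝ) * (1 / (b : ℝ) ^ k)))
      (fun k => DependsOn.measurable_digits (m := N k + k) fun y z h => by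
        have := DependsOn.wordMean_of_startCount (indicatorOf j)
          (fun w : Fin k → Fin b => dependsOn_startCount w (N k)) h
        simp only at this ⊢
        rw [this])
      (fun k => integrable_wordMean_sub_sq k _ _ _) hsum
      (fun k => by
        refine (poissonVariance_le k j (N k)).trans ?_
        have h1 : (N k : ℝ) ≤ (l + 1) * (b : ℝ) ^ k :=
          (hN2 k).trans (by nlinarith [one_le_pow₀ hb1.le (n := k)])
        rw [one_div_pow (b : ℝ) k, pow_one]
        have h2 := mul_le_mul_of_nonneg_left h1
          (by positivity : (0 : ℝ) ≤ 84 * (k + 1) * (1 / (b : ℝ) ^ k) ^ 2)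
        refine h2.trans (le_of_eq ?_)
        have := (hbk k).ne'
        field_simp)
    filter_upwards [hae] with y hy
    have := hy.add hprob
    simpa only [sub_add_cancel, zero_add, poissonCount_eq hl'.le, wordRatio_eq_wordMean] using this
  filter_upwards [ae_all_iff.2 key] with y hy
  exact isPoissonGenericSeq_of_rat fun l hl j => hy (⟨l, hl⟩, j)

end AlmostSure

-- Almost every sequence is normal

section AlmostSureNormality

open MeasureTheory ProbabilityTheory

variable {b : ℕ}

/-- The deviation of the number of occurrences of `w` from its expectation. -/
noncomputable def countDeviation (y : ℕ → Fin b) {k : ℕ} (w : Fin k → Fin b) (n : ℕ) : ℝ :=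
  startCount y w n - n * (1 / (b : ℝ) ^ k)

theorem dependsOn_countDeviation {k : ℕ} (w : Fin k → Fin b) (n : ℕ) :
    DependsOn (fun y : ℕ → Fin b => countDeviation y w n) (Set.Iio (n + k)) := by
  intro y z h
  have := dependsOn_startCount w n h
  simp only [countDeviation] at this ⊢
  rw [this]

variable [NeZero b]

theorem one_div_pow_base_le_one (k : ℕ) : 1 / (b : ℝ) ^ k ≤ 1 := by
  have : (1 : ℝ) ≤ b := by exact_mod_cast NeZero.one_le
  exact div_le_one_of_le₀ (one_le_pow₀ this) (by positivity)

theorem abs_countDeviation_sub_le (y : ℕ → Fin b) {k : ℕ} (w : Fin k → Fin b) {m n : ℕ}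
    (h : m ≤ n) : |countDeviation y w n - countDeviation y w m| ≤ n - m := by
  have h1 := abs_startCount_sub_le y w h
  have h2 := startCount_mono y w h
  have h2' : (startCount y w m : ℝ) ≤ startCount y w n := by exact_mod_cast h2
  have h3 : (m : ℝ) ≤ n := by exact_mod_cast h
  have h4 := one_div_pow_base_le_one (b := b) k
  have h5 : 0 ≤ 1 / (b : ℝ) ^ k := by positivity
  have h6 := mul_le_mul_of_nonneg_left h4 (sub_nonneg.2 h3)
  have h7 := mul_nonneg (sub_nonneg.2 h3) h5
  rw [abs_of_nonneg (by linarith)] at h1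
  unfold countDeviation
  rw [abs_le]
  constructor <;> linarith

theorem integrable_countDeviation_sq {k : ℕ} (w : Fin k → Fin b) (n : ℕ) :
    Integrable (fun y => countDeviation y w n ^ 2) (digitMeasure b) :=
  DependsOn.integrable_digits (m := n + k) fun y z h => by
    have := dependsOn_countDeviation w n h
    simp only at this ⊢
    rw [this]

/-- The increment at `n` has mean zero given the digits before `n`, so it is uncorrelated with the
deviation at `n - k`. Going back `k` steps costs `2 * k`, and the squared increment at most one. -/
theorem integral_countDeviation_sq_le {k : ℕ} (w : Fin k → Fin b) (n : ℕ) :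
    ∫ y, countDeviation y w n ^ 2 ∂digitMeasure b ≤ (2 * k + 1) * n := by
  induction n with
  | zero => simp [countDeviation, startCount]
  | succ n ih =>
    have hq1 := one_div_pow_base_le_one (b := b) k
    have hq0 : 0 ≤ 1 / (b : ℝ) ^ k := by positivity
    set q : ℝ := 1 / (b : ℝ) ^ k with hq
    have hu : DependsOn (fun y : ℕ → Fin b => countDeviation y w (n - k)) (Set.Iio n) := by
      intro y z h
      have := dependsOn_startCount_sub w n h
      simp only [countDeviation] at this ⊢
      rw [this]
    have hu' : DependsOn (fun y : ℕ → Fin b => countDeviation y w (n - k) *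
        if window y k n = w then 1 else 0) (Set.Iio (n + k)) := by
      intro y z h
      have h1 := hu fun i hi => h i (lt_of_lt_of_le hi (Nat.le_add_right n k))
      have h2 : window y k n = window z k n :=
        window_congr fun t ht => h _ (by simp only [Set.mem_Iio]; omega)
      simp only at h1 ⊢
      rw [h1, h2]
    have hkey := integral_mul_window_const hu w
    have i1 := integrable_countDeviation_sq w n
    have hpt : ∀ y : ℕ → Fin b, countDeviation y w (n + 1) ^ 2 ≤ countDeviation y w n ^ 2 +
        (2 * (countDeviation y w (n - k) * (if window y k n = w then 1 else 0)) -
          2 * q * countDeviation y w (n - k)) + (2 * k + 1) := by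
      intro y
      have h1 : countDeviation y w (n + 1) =
          countDeviation y w n + ((if window y k n = w then 1 else 0) - q) := by
        simp only [countDeviation, startCount_succ]
        push_cast
        ring
      have h2 := abs_countDeviation_sub_le y w (Nat.sub_le n k)
      have h2' : (n : ℝ) - (n - k : ℕ) ≤ k := by
        have : n ≤ n - k + k := by omega
        have : (n : ℝ) ≤ (n - k : ℕ) + k := by exact_mod_cast this
        linarith
      have h3 : |(if window y k n = w then 1 else 0) - q| ≤ 1 := by
        rw [abs_le]
        split_ifs <;> constructor <;> linarith
      rw [h1]
      set X : ℝ := if window y k n = w then 1 else 0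
      set u := countDeviation y w n
      set u' := countDeviation y w (n - k)
      have h4 : (u - u') * (X - q) ≤ k * 1 := by
        refine (le_abs_self _).trans ?_
        rw [abs_mul]
        exact mul_le_mul (h2.trans h2') h3 (abs_nonneg _) (by positivity)
      have h5 : (X - q) ^ 2 ≤ 1 := by
        rw [← sq_abs]
        exact pow_le_one₀ (abs_nonneg _) h3
      nlinarith
    have i2 := hu.integrable_digits
    have i3 := hu'.integrable_digits
    have i4 : Integrable (fun y => 2 * (countDeviation y w (n - k) *
        (if window y k n = w then 1 else 0)) - 2 * q * countDeviation y w (n - k))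
        (digitMeasure b) := (i3.const_mul 2).sub (i2.const_mul (2 * q))
    have i5 : Integrable (fun y => countDeviation y w n ^ 2 + (2 * (countDeviation y w (n - k) *
        (if window y k n = w then 1 else 0)) - 2 * q * countDeviation y w (n - k)))
        (digitMeasure b) := i1.add i4
    have hint := integral_mono (integrable_countDeviation_sq w (n + 1))
      (i5.add (integrable_const _)) hpt
    simp only [Pi.add_apply] at hint
    rw [integral_add i5 (integrable_const _), integral_add i1 i4,
      integral_sub (i3.const_mul 2) (i2.const_mul (2 * q)), integral_const_mul,
      integral_const_mul, hkey] at hint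
    simp only [integral_const, smul_eq_mul, probReal_univ, one_mul] at hint
    push_cast
    linarith

/-- Along the squares `m ^ 2` the normalized second moments are of order `1 / m ^ 2`, hence
summable; between consecutive squares the deviation moves by at most `2 * m`. -/
theorem ae_isNormalSeq : ∀ᵐ y ∂digitMeasure b, IsNormalSeq y := by
  have key : ∀ p : Σ k : ℕ, Fin k → Fin b, ∀ᵐ y ∂digitMeasure b,
      Tendsto (fun n : ℕ => (startCount y p.2 n : ℝ) / n) atTop (𝓝 (1 / (b : ℝ) ^ p.1)) := by
    rintro ⟨k, w⟩
    have hae := ae_tendsto_zero_of_summable_integral_sq (μ := digitMeasure b)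
      (f := fun m y => countDeviation y w (m ^ 2) * (1 / (m : ℝ) ^ 2))
      (c := fun m => (2 * k + 1) * (1 / (m : ℝ) ^ 2))
      (fun m => (dependsOn_countDeviation w _).measurable_digits.mul_const _)
      (fun m => by
        simp only [mul_pow]
        exact (integrable_countDeviation_sq w _).mul_const _)
      ((Real.summable_one_div_nat_pow.2 one_lt_two).mul_left _)
      (fun m => by
        simp only [mul_pow]
        rw [integral_mul_const]
        refine (mul_le_mul_of_nonneg_right (integral_countDeviation_sq_le w (m ^ 2))
          (by positivity)).trans (le_of_eq ?_)
        rcases eq_or_ne m 0 with rfl | hm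
        · simp
        · have : (m : ℝ) ≠ 0 := by exact_mod_cast hm
          push_cast
          field_simp)
    filter_upwards [hae] with y hy
    have hsqrt : Tendsto Nat.sqrt atTop atTop :=
      tendsto_atTop.2 fun a => (eventually_ge_atTop (a * a)).mono fun n hn => Nat.le_sqrt.2 hn
    have h1 := (hy.comp hsqrt).abs.add
      ((tendsto_const_div_atTop_nhds_zero_nat (2 : ℝ)).comp hsqrt)
    simp only [Function.comp_def, abs_zero, add_zero] at h1
    have h2 : Tendsto (fun n : ℕ => countDeviation y w n / n) atTop (𝓝 0) := by
      refine squeeze_zero_norm' ?_ h1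
      filter_upwards [eventually_gt_atTop 0] with n hn
      have hm : 0 < n.sqrt := Nat.sqrt_pos.2 hn
      have hm' : (0 : ℝ) < n.sqrt := by exact_mod_cast hm
      have hmn : n.sqrt ^ 2 ≤ n := Nat.sqrt_le' n
      have hmn' : ((n.sqrt : ℕ) : ℝ) ^ 2 ≤ n := by exact_mod_cast hmn
      have hnm : n ≤ n.sqrt ^ 2 + 2 * n.sqrt := by
        have := Nat.sqrt_le_add n
        rw [sq]
        omega
      have hnm' : (n : ℝ) ≤ (n.sqrt : ℝ) ^ 2 + 2 * n.sqrt := by exact_mod_cast hnm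
      have h3 := abs_countDeviation_sub_le y w hmn
      push_cast at h3
      have h4 : |countDeviation y w n| ≤ |countDeviation y w (n.sqrt ^ 2)| + 2 * n.sqrt := by
        have := abs_sub_abs_le_abs_sub (countDeviation y w n) (countDeviation y w (n.sqrt ^ 2))
        linarith
      rw [norm_div, Real.norm_eq_abs, Real.norm_natCast]
      refine (div_le_div₀ (by positivity) h4 (by positivity) hmn').trans (le_of_eq ?_)
      rw [abs_mul, abs_of_nonneg (by positivity : (0 : ℝ) ≤ 1 / (n.sqrt : ℝ) ^ 2)]
      field_simp
    have h3 := h2.add_const (1 / (b : ℝ) ^ k)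
    rw [zero_add] at h3
    refine h3.congr' ?_
    filter_upwards [eventually_gt_atTop 0] with n hn
    have : (n : ℝ) ≠ 0 := by positivity
    simp only [countDeviation]
    rw [sub_div, mul_div_cancel_left₀ _ this]
    ring
  filter_upwards [ae_all_iff.2 key] with y hy
  exact isNormalSeq_iff.2 fun k w => hy ⟨k, w⟩

theorem exists_isNormalSeq_and_isPoissonGenericSeq {b : ℕ} (hb : 2 ≤ b) :
    ∃ y : ℕ → Fin b, IsNormalSeq y ∧ IsPoissonGenericSeq y := by
  have : NeZero b := ⟨by omega⟩
  exact ((ae_isNormalSeq (b := b)).and (ae_isPoissonGenericSeq hb)).exists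

end AlmostSureNormality

/-! ### Splicing non-normal and non-Poisson blocks into a sequence -/

section Scales

variable {b : ℕ}

/-- A rapidly growing sequence of powers of `b`. -/
def scale (b p : ℕ) : ℕ := b ^ ((p + 2) ^ 2)

/-- The end of the part of a sequence that belongs to earlier scales. -/
def scaleStart (b : ℕ) : ℕ → ℕ
  | 0 => 0
  | p + 1 => 2 * scale b p

theorem scale_succ (b p : ℕ) : scale b (p + 1) = scale b p * b ^ (2 * p + 5) := by
  unfold scale
  rw [← pow_add]
  congr 1
  ring

theorem sixteen_le_scale (hb : 2 ≤ b) (p : ℕ) : 16 ≤ scale b p := by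
  calc 16 = 2 ^ 4 := by norm_num
    _ ≤ b ^ 4 := Nat.pow_le_pow_left hb 4
    _ ≤ b ^ ((p + 2) ^ 2) := Nat.pow_le_pow_right (by omega) (Nat.pow_le_pow_left (show 2 ≤ p + 2 by omega) 2)

theorem four_mul_scale_le (hb : 2 ≤ b) (p : ℕ) : 4 * scale b p ≤ scale b (p + 1) := by
  rw [scale_succ, mul_comm]
  refine Nat.mul_le_mul_left _ ?_
  calc 4 = 2 ^ 2 := by norm_num
    _ ≤ b ^ 2 := Nat.pow_le_pow_left hb 2
    _ ≤ b ^ (2 * p + 5) := Nat.pow_le_pow_right (by omega) (by omega)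

theorem strictMono_scale (hb : 2 ≤ b) : StrictMono (scale b) :=
  strictMono_nat_of_lt_succ fun p => by
    have := four_mul_scale_le hb p
    have := sixteen_le_scale hb p
    omega

theorem two_mul_scaleStart_le (hb : 2 ≤ b) (p : ℕ) : 2 * scaleStart b p ≤ scale b p := by
  cases p with
  | zero => simp [scaleStart]
  | succ p =>
    have := four_mul_scale_le hb p
    rw [scaleStart]
    omega

/-- Quadratic exponents make the ratio `b ^ (2 * p + 5)` of consecutive scales unbounded, so
whatever happened at earlier scales is negligible at this one. -/
theorem scaleStart_div_scale_le (hb : 2 ≤ b) (p : ℕ) :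
    (scaleStart b p : ℝ) / scale b p ≤ 2 / p := by
  cases p with
  | zero => simp [scaleStart]
  | succ p =>
    have h1 : (0 : ℝ) < scale b p := by
      have := sixteen_le_scale hb p
      exact_mod_cast (by omega : 0 < scale b p)
    have h2 : p + 1 ≤ b ^ (2 * p + 5) :=
      (Nat.lt_pow_self (by omega)).le.trans (Nat.pow_le_pow_right (by omega) (by omega))
    have h3 : ((p + 1 : ℕ) : ℝ) ≤ (b : ℝ) ^ (2 * p + 5) := by exact_mod_cast h2
    have h4 : (0 : ℝ) < ((p + 1 : ℕ) : ℝ) := by positivity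
    rw [scaleStart, scale_succ]
    push_cast at h3 h4 ⊢
    rw [mul_comm (2 : ℝ), mul_div_mul_left _ _ h1.ne']
    exact div_le_div_of_nonneg_left (by norm_num) h4 h3

theorem tendsto_scaleStart_div_scale (hb : 2 ≤ b) :
    Tendsto (fun p => (scaleStart b p : ℝ) / scale b p) atTop (𝓝 0) :=
  squeeze_zero (fun p => by positivity) (scaleStart_div_scale_le hb)
    (tendsto_const_div_atTop_nhds_zero_nat 2)

open Classical in
/-- The index of the scale to which the position `j` belongs. -/
noncomputable def stage (b j : ℕ) : ℕ :=
  if h : ∃ p, j < 2 * scale b p then Nat.find h else 0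

theorem stage_eq (hb : 2 ≤ b) {j p : ℕ} (h1 : scaleStart b p ≤ j) (h2 : j < 2 * scale b p) :
    stage b j = p := by
  have h : ∃ p, j < 2 * scale b p := ⟨p, h2⟩
  rw [stage, dif_pos h, Nat.find_eq_iff]
  refine ⟨h2, fun m hm => ?_⟩
  cases p with
  | zero => omega
  | succ p =>
    have := (strictMono_scale hb).monotone (Nat.le_of_lt_succ hm)
    rw [scaleStart] at h1
    omega

/-- The index of the last scale that is relevant for the positions before `M`. -/
theorem exists_scale_index (hb : 2 ≤ b) : ∃ r : ℕ → ℕ, Tendsto r atTop atTop ∧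
    ∀ᶠ M in atTop, scale b (r M) ≤ 2 * M ∧ 2 * M < scale b (r M + 1) := by
  have h : ∀ M, ∃ p, 2 * M < scale b (p + 1) := fun M =>
    ⟨2 * M, lt_of_lt_of_le (Nat.lt_succ_self _) (strictMono_scale hb).le_apply⟩
  refine ⟨fun M => Nat.find (h M), tendsto_atTop.2 fun p => ?_, ?_⟩
  · filter_upwards [eventually_ge_atTop (scale b p)] with M hM
    rw [Nat.le_find_iff]
    intro m hm
    have := (strictMono_scale hb).monotone (Nat.succ_le_of_lt hm)
    simp only [Nat.succ_eq_add_one] at this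
    omega
  · filter_upwards [eventually_ge_atTop (scale b 0)] with M hM
    refine ⟨?_, Nat.find_spec (h M)⟩
    rcases Nat.eq_zero_or_pos (Nat.find (h M)) with h0 | h0
    · rw [h0]
      omega
    · have := Nat.find_min (h M) (m := Nat.find (h M) - 1) (by omega)
      rw [Nat.sub_add_cancel h0] at this
      omega

end Scales

-- The spliced sequence and its comparison with `y`

section Splice

variable {b : ℕ}

/-- The beginning of the copied block of the scale `p`. -/
def copyStart (b : ℕ) (h : ℕ → ℕ) (p : ℕ) : ℕ := scale b p - scale b p / (h p + 2)

/-- The end of the padded block of the scale `p`. -/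
def padEnd (b : ℕ) (g : ℕ → ℕ) (p : ℕ) : ℕ := scale b p + scale b p / (g p + 2) + 2

/-- `y` with the block from `s` to `e` replaced by a copy of the initial segment. -/
def copyPrefix (y : ℕ → Fin b) (s e j : ℕ) : Fin b :=
  if s ≤ j ∧ j < e then y (j - s) else y j

/-- The sequence `y`, where at every scale `N = scale b p` a proportion of about `1 / h p`
before `N` is replaced by a copy of the initial segment of `y`, and a proportion of about
`1 / g p` after `N` is replaced by zeros (after a single digit one). -/
noncomputable def splice [NeZero b] (y : ℕ → Fin b) (g h : ℕ → ℕ) (j : ℕ) : Fin b :=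
  if scale b (stage b j) ≤ j ∧ j < padEnd b g (stage b j) then
    if j = scale b (stage b j) then Fin.ofNat b 1 else 0
  else copyPrefix y (copyStart b h (stage b j)) (scale b (stage b j)) j

theorem copyStart_le (h : ℕ → ℕ) (p : ℕ) : copyStart b h p ≤ scale b p := Nat.sub_le _ _

/-- Due to the `+ 2` in the denominator, the copied block is no longer than what precedes it, for
every `h`. -/
theorem scale_le_two_mul_copyStart (h : ℕ → ℕ) (p : ℕ) : scale b p ≤ 2 * copyStart b h p := by
  have : scale b p / (h p + 2) ≤ scale b p / 2 := Nat.div_le_div_left (by omega) (by omega)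
  unfold copyStart
  omega

theorem scale_add_two_le_padEnd (g : ℕ → ℕ) (p : ℕ) : scale b p + 2 ≤ padEnd b g p :=
  Nat.add_le_add_right (Nat.le_add_right _ _) 2

theorem padEnd_le (hb : 2 ≤ b) (g : ℕ → ℕ) (p : ℕ) : padEnd b g p ≤ 2 * scale b p := by
  have : scale b p / (g p + 2) ≤ scale b p / 2 := Nat.div_le_div_left (by omega) (by omega)
  have := sixteen_le_scale hb p
  unfold padEnd
  omega

theorem cast_div_le (N m : ℕ) : ((N / (m + 2) : ℕ) : ℝ) ≤ 1 / ((m : ℝ) + 2) * N := by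
  refine Nat.cast_div_le.trans (le_of_eq ?_)
  push_cast
  ring

theorem tendsto_one_div_add_two {g : ℕ → ℕ} (hg : Tendsto g atTop atTop) :
    Tendsto (fun p => 1 / ((g p : ℝ) + 2)) atTop (𝓝 0) := by
  have : Tendsto (fun p => (g p : ℝ) + 2) atTop atTop :=
    tendsto_atTop_add_const_right _ _ (tendsto_natCast_atTop_atTop.comp hg)
  simpa [Pi.inv_def] using this.inv_tendsto_atTop

theorem tendsto_natCast_mul_one_div_pow (hb : 2 ≤ b) :
    Tendsto (fun k : ℕ => (k : ℝ) * (1 / (b : ℝ) ^ k)) atTop (𝓝 0) := by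
  have hb1 : (1 : ℝ) < b := by exact_mod_cast hb
  simpa [div_eq_mul_inv] using tendsto_pow_const_div_const_pow_of_one_lt 1 hb1

theorem tendsto_one_div_pow (hb : 2 ≤ b) :
    Tendsto (fun k : ℕ => 1 / (b : ℝ) ^ k) atTop (𝓝 0) := by
  have hb1 : (1 : ℝ) < b := by exact_mod_cast hb
  simpa [← inv_pow] using tendsto_pow_atTop_nhds_zero_of_lt_one (by positivity)
    (inv_lt_one_of_one_lt₀ hb1)

variable [NeZero b]

theorem splice_of_stage (hb : 2 ≤ b) (y : ℕ → Fin b) (g h : ℕ → ℕ) {p j : ℕ}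
    (h1 : scaleStart b p ≤ j) (h2 : j < 2 * scale b p) :
    splice y g h j = if scale b p ≤ j ∧ j < padEnd b g p then
      if j = scale b p then Fin.ofNat b 1 else 0
      else copyPrefix y (copyStart b h p) (scale b p) j := by
  simp only [splice, stage_eq hb h1 h2]

/-- The description by scale `p` stays valid up to half of the next scale, because the next copied
block begins no earlier. This is the origin of the factor two in `exists_scale_index`. -/
theorem splice_eq_copyPrefix (hb : 2 ≤ b) (y : ℕ → Fin b) (g h : ℕ → ℕ) {p j : ℕ}
    (h1 : scaleStart b p ≤ j) (h2 : 2 * j < scale b (p + 1))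
    (h3 : j < scale b p ∨ padEnd b g p ≤ j) :
    splice y g h j = copyPrefix y (copyStart b h p) (scale b p) j := by
  rcases lt_or_ge j (2 * scale b p) with h4 | h4
  · rw [splice_of_stage hb y g h h1 h4, if_neg (by omega)]
  · have h5 := scale_le_two_mul_copyStart (b := b) h (p + 1)
    rw [splice_of_stage hb y g h (p := p + 1) h4 (by omega), if_neg (by omega), copyPrefix,
      copyPrefix, if_neg (by omega), if_neg (by omega)]

theorem splice_scale (hb : 2 ≤ b) (y : ℕ → Fin b) (g h : ℕ → ℕ) (p : ℕ) :
    (splice y g h (scale b p) : ℕ) = 1 := by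
  have h1 := two_mul_scaleStart_le hb p
  have h2 := sixteen_le_scale hb p
  rw [splice_of_stage hb y g h (p := p) (by omega) (by omega), if_pos ⟨le_rfl, by
    have := scale_add_two_le_padEnd (b := b) g p; omega⟩, if_pos rfl]
  simp [Nat.mod_eq_of_lt (show 1 < b by omega)]

theorem splice_pad (hb : 2 ≤ b) (y : ℕ → Fin b) (g h : ℕ → ℕ) {p j : ℕ} (h1 : scale b p < j)
    (h2 : j < padEnd b g p) : splice y g h j = 0 := by
  have h3 := two_mul_scaleStart_le hb p
  have h4 := padEnd_le hb g p
  rw [splice_of_stage hb y g h (p := p) (by omega) (by omega), if_pos ⟨h1.le, h2⟩,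
    if_neg (by omega)]

/-- The padding contains a one and at least one zero at every scale, whatever `g` is. The ones give
infinitely many nonzero digits, and a zero keeps the value below one. -/
theorem isExpansion_splice (hb : 2 ≤ b) (y : ℕ → Fin b) (g h : ℕ → ℕ) :
    Real.ofDigits (splice y g h) < 1 ∧
      IsExpansion b (Real.ofDigits (splice y g h)) (splice y g h) := by
  have h1 : Real.ofDigits (splice y g h) < 1 := by
    refine lt_of_le_of_ne (Real.ofDigits_le_one _) fun h1 => ?_
    have h2 := eq_last_of_ofDigits_eq_one (scale b 0 + 1) h1
    rw [splice_pad hb y g h (p := 0) (by omega)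
      (by have := scale_add_two_le_padEnd (b := b) g 0; omega)] at h2
    simp only [Fin.val_zero] at h2
    omega
  refine ⟨h1, (Int.fract_eq_self.2 ⟨Real.ofDigits_nonneg _, h1⟩).symm, ?_⟩
  refine frequently_atTop.2 fun a => ⟨scale b a, (strictMono_scale hb).le_apply, ?_⟩
  rw [splice_scale hb]
  exact one_ne_zero

/-- The digit at `j` uses `g` and `h` only at the index `stage b j`. -/
theorem isLocallyConstant_splice {X : Type*} [TopologicalSpace X] (y : ℕ → Fin b)
    {g h : X → ℕ → ℕ} (hg : ∀ n, IsLocallyConstant fun x => g x n)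
    (hh : ∀ n, IsLocallyConstant fun x => h x n) (j : ℕ) :
    IsLocallyConstant fun x => splice y (g x) (h x) j :=
  ((hg (stage b j)).prodMk (hh (stage b j))).comp fun q : ℕ × ℕ =>
    splice y (fun _ => q.1) (fun _ => q.2) j

theorem card_windowDiff_copyPrefix_le (hb : 2 ≤ b) (y : ℕ → Fin b) (g h : ℕ → ℕ) {k n p : ℕ}
    (hn : 2 * (n + k) < scale b (p + 1)) :
    (windowDiff (splice y g h) (copyPrefix y (copyStart b h p) (scale b p)) k n).card ≤
      scaleStart b p + scale b p / (g p + 2) + (k + 2) := by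
  have : windowDiff (splice y g h) (copyPrefix y (copyStart b h p) (scale b p)) k n ⊆
      Finset.range (scaleStart b p) ∪ Finset.Ico (scale b p - k) (padEnd b g p) := by
    intro i hi
    obtain ⟨hi, hne⟩ := Finset.mem_filter.1 hi
    rw [Finset.mem_range] at hi
    rw [Finset.mem_union, Finset.mem_range, Finset.mem_Ico]
    by_contra hcon
    refine hne (window_congr fun t ht => ?_)
    exact splice_eq_copyPrefix hb y g h (by omega) (by omega) (by omega)
  refine (Finset.card_le_card this).trans ((Finset.card_union_le _ _).trans ?_)
  rw [Finset.card_range, Nat.card_Ico, padEnd]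
  generalize scale b p / (g p + 2) = q
  omega

theorem card_windowDiff_splice_le (hb : 2 ≤ b) (y : ℕ → Fin b) (g h : ℕ → ℕ) {k n p : ℕ}
    (hn : 2 * (n + k) < scale b (p + 1)) :
    (windowDiff (splice y g h) y k n).card ≤
      scaleStart b p + scale b p / (h p + 2) + scale b p / (g p + 2) + (k + 2) := by
  have : windowDiff (splice y g h) y k n ⊆
      Finset.range (scaleStart b p) ∪ Finset.Ico (copyStart b h p - k) (padEnd b g p) := by
    intro i hi
    obtain ⟨hi, hne⟩ := Finset.mem_filter.1 hi
    rw [Finset.mem_range] at hi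
    rw [Finset.mem_union, Finset.mem_range, Finset.mem_Ico]
    by_contra hcon
    refine hne (window_congr fun t ht => ?_)
    have h1 := copyStart_le (b := b) h p
    have h2 := scale_add_two_le_padEnd (b := b) g p
    rw [splice_eq_copyPrefix hb y g h (p := p) (by omega) (by omega) (by omega), copyPrefix,
      if_neg (by omega)]
  refine (Finset.card_le_card this).trans ((Finset.card_union_le _ _).trans ?_)
  have h1 : scale b p / (h p + 2) ≤ scale b p := Nat.div_le_self _ _
  rw [Finset.card_range, Nat.card_Ico, padEnd, copyStart]
  generalize scale b p / (g p + 2) = q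
  generalize scale b p / (h p + 2) = q' at h1 ⊢
  generalize scale b p = N at h1 ⊢
  omega

/-! ### Poisson genericity of spliced sequences -/

/-- The relevant scale is at most a constant times `b ^ k`, and the windows changed form a vanishing
fraction of it plus `k + 2`; divided by `b ^ k` this tends to zero. -/
theorem isPoissonGenericSeq_splice (hb : 2 ≤ b) {y : ℕ → Fin b} (hy : IsPoissonGenericSeq y)
    {g h : ℕ → ℕ} (hg : Tendsto g atTop atTop) (hh : Tendsto h atTop atTop) :
    IsPoissonGenericSeq (splice y g h) := by
  intro l hl j
  obtain ⟨r, hr, hrM⟩ := exists_scale_index hb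
  let n : ℕ → ℕ := fun k => ⌊l * (b : ℝ) ^ k⌋₊ + 1
  let u : ℕ → ℝ := fun p => (scaleStart b p : ℝ) / scale b p + 1 / ((h p : ℝ) + 2) +
    1 / ((g p : ℝ) + 2)
  have hu0 : ∀ p, 0 ≤ u p := fun p => by positivity
  have hu : Tendsto u atTop (𝓝 0) := by
    simpa [u] using ((tendsto_scaleStart_div_scale hb).add (tendsto_one_div_add_two hh)).add
      (tendsto_one_div_add_two hg)
  have hM : Tendsto (fun k => n k + k) atTop atTop :=
    tendsto_atTop_mono (fun k => Nat.le_add_left k _) tendsto_id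
  have hbound : ∀ᶠ k in atTop,
      |wordRatio (splice y g h) k j (n k) - wordRatio y k j (n k)| ≤
        2 * (2 * (l + 2) * u (r (n k + k)) + (k * (1 / (b : ℝ) ^ k) + 2 * (1 / (b : ℝ) ^ k))) := by
    filter_upwards [hM.eventually hrM] with k hk
    refine (abs_wordRatio_sub_le _ _ _ _ _).trans ?_
    set p := r (n k + k)
    have h1 := card_windowDiff_splice_le hb y g h hk.2
    have hN : (0 : ℝ) < scale b p := by
      have := sixteen_le_scale hb p
      exact_mod_cast (by omega : 0 < scale b p)
    have h2 : ((windowDiff (splice y g h) y k (n k)).card : ℝ) ≤ u p * scale b p + (k + 2) := by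
      have h3 : ((windowDiff (splice y g h) y k (n k)).card : ℝ) ≤ scaleStart b p +
          ((scale b p / (h p + 2) : ℕ) : ℝ) + ((scale b p / (g p + 2) : ℕ) : ℝ) + (k + 2) := by
        exact_mod_cast h1
      have h4 := cast_div_le (scale b p) (h p)
      have h5 := cast_div_le (scale b p) (g p)
      have h6 : (scaleStart b p : ℝ) / scale b p * scale b p = scaleStart b p :=
        div_mul_cancel₀ _ hN.ne'
      simp only [u, add_mul, h6]
      linarith
    have hbk : (0 : ℝ) < (b : ℝ) ^ k := by
      have : (0 : ℝ) < b := by exact_mod_cast NeZero.pos b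
      positivity
    have h3 : (scale b p : ℝ) ≤ 2 * ((l + 2) * (b : ℝ) ^ k) := by
      have h4 : (scale b p : ℝ) ≤ 2 * ((n k : ℝ) + k) := by exact_mod_cast hk.1
      have h5 : (n k : ℝ) ≤ l * (b : ℝ) ^ k + 1 := by
        simpa [n] using Nat.floor_le (by positivity)
      have h6 : k + 1 ≤ b ^ k := Nat.lt_pow_self (by omega)
      have h7 : (k : ℝ) + 1 ≤ (b : ℝ) ^ k := by exact_mod_cast h6
      nlinarith
    have h4 := mul_le_mul_of_nonneg_left h3 (hu0 p)
    have h5 : 1 / (b : ℝ) ^ k * (b : ℝ) ^ k = 1 := one_div_mul_cancel hbk.ne'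
    have h6 := mul_le_mul_of_nonneg_left (h2.trans (by linarith :
      u p * scale b p + (k + 2) ≤ u p * (2 * ((l + 2) * (b : ℝ) ^ k)) + (k + 2)))
      (by positivity : (0 : ℝ) ≤ 1 / (b : ℝ) ^ k * 2)
    refine (le_of_eq ?_).trans (h6.trans (le_of_eq ?_))
    · ring
    · linear_combination (4 * u p * (l + 2)) * h5
  have hzero : Tendsto (fun k => wordRatio (splice y g h) k j (n k) - wordRatio y k j (n k))
      atTop (𝓝 0) := by
    refine squeeze_zero_norm' hbound ?_
    have h1 := (hu.comp (hr.comp hM)).const_mul (2 * (l + 2))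
    have h2 := (tendsto_natCast_mul_one_div_pow hb).add ((tendsto_one_div_pow hb).const_mul 2)
    have := (h1.add h2).const_mul 2
    simpa [Function.comp_def] using this
  have := hzero.add (hy l hl j)
  simpa [poissonCount_eq hl.le, n] using this

/-- Windows inside the copied block already occur in `y` before `copyStart`. So a word missing in
`y` up to there can appear in the splice only at a bad position: within earlier scales or across one
of the two ends of the block. -/
theorem wordRatio_zero_le_splice (hb : 2 ≤ b) (y : ℕ → Fin b) (g h : ℕ → ℕ) {k : ℕ} (hk : 0 < k)
    (p : ℕ) :
    wordRatio y k 0 (copyStart b h p) ≤ wordRatio (splice y g h) k 0 (scale b p + 1) +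
      1 / (b : ℝ) ^ k * (scaleStart b p + 2 * k) := by
  let bad : Finset ℕ := Finset.range (scaleStart b p) ∪
    (Finset.Ico (copyStart b h p - k) (copyStart b h p) ∪
      Finset.Ico (scale b p + 1 - k) (scale b p + 1))
  have hbad : bad.card ≤ scaleStart b p + 2 * k := by
    refine (Finset.card_union_le _ _).trans ?_
    have := Finset.card_union_le (Finset.Ico (copyStart b h p - k) (copyStart b h p))
      (Finset.Ico (scale b p + 1 - k) (scale b p + 1))
    rw [Nat.card_Ico, Nat.card_Ico] at this
    rw [Finset.card_range]
    omega
  have hsub : (Finset.univ.filter fun w : Fin k → Fin b => startCount y w (copyStart b h p) = 0) ⊆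
      (Finset.univ.filter fun w : Fin k → Fin b =>
        startCount (splice y g h) w (scale b p + 1) = 0) ∪
        bad.image (window (splice y g h) k) := by
    intro w hw
    simp only [Finset.mem_union, Finset.mem_filter, Finset.mem_univ, true_and, startCount,
      Finset.card_eq_zero, Finset.filter_eq_empty_iff, Finset.mem_range, Finset.mem_image] at hw ⊢
    by_contra! hcon
    obtain ⟨⟨i, hi, hiw⟩, hcon⟩ := hcon
    have hib : i ∉ bad := fun h => hcon i h hiw
    simp only [bad, Finset.mem_union, Finset.mem_range, Finset.mem_Ico] at hib
    have h1 := copyStart_le (b := b) h p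
    have h2 := scale_le_two_mul_copyStart (b := b) h p
    have h3 := four_mul_scale_le hb p
    have h4 := sixteen_le_scale hb p
    rcases lt_or_ge i (copyStart b h p) with h5 | h5
    · refine hw h5 (hiw ▸ (window_congr fun t ht => ?_))
      rw [splice_eq_copyPrefix hb y g h (p := p) (by omega) (by omega) (by omega), copyPrefix,
        if_neg (by omega)]
    · refine hw (x := i - copyStart b h p) (by omega) (hiw ▸ (window_congr fun t ht => ?_))
      rw [splice_eq_copyPrefix hb y g h (p := p) (by omega) (by omega) (by omega), copyPrefix,
        if_pos (by omega)]
      congr 1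
      omega
  have hcard := (Finset.card_le_card hsub).trans ((Finset.card_union_le _ _).trans
    (Nat.add_le_add_left (Finset.card_image_le.trans hbad) _))
  unfold wordRatio
  rw [← mul_add]
  refine mul_le_mul_of_nonneg_left ?_ (by positivity)
  exact_mod_cast hcard

/-- Test `j = 0` and parameter one at `k = (p + 2) ^ 2`, where `b ^ k` is the scale. Whenever `h p <
B`, at least the words missing in `y` up to `l * b ^ k`, except a vanishing proportion, are missing,
and `exp (-l) > exp (-1)`. -/
theorem not_isPoissonGenericSeq_splice (hb : 2 ≤ b) {y : ℕ → Fin b} (hy : IsPoissonGenericSeq y)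
    {g h : ℕ → ℕ} (hh : ¬Tendsto h atTop atTop) : ¬IsPoissonGenericSeq (splice y g h) := by
  intro hd
  simp only [tendsto_atTop, not_forall, not_eventually, not_le] at hh
  obtain ⟨B, hB⟩ := hh
  have hl : (0 : ℝ) < 1 - 1 / ((B : ℝ) + 2) := by
    rw [sub_pos, div_lt_one (by positivity)]
    linarith [(Nat.cast_nonneg B : (0 : ℝ) ≤ B)]
  set l : ℝ := 1 - 1 / ((B : ℝ) + 2) with hldef
  have hk : Tendsto (fun p : ℕ => (p + 2) ^ 2) atTop atTop :=
    tendsto_atTop_mono (fun p => by simp only [id]; nlinarith) tendsto_id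
  have h1 := (hd 1 one_pos 0).comp hk
  have h2 := (hy l hl 0).comp hk
  have hscale : ∀ p, (scale b p : ℝ) = (b : ℝ) ^ ((p + 2) ^ 2) := fun p => by
    simp [scale]
  have h3 : Tendsto (fun p => 1 / (b : ℝ) ^ ((p + 2) ^ 2) *
      (scaleStart b p + 2 * ((p + 2) ^ 2 : ℕ))) atTop (𝓝 0) := by
    have := (tendsto_scaleStart_div_scale hb).add
      (((tendsto_natCast_mul_one_div_pow hb).comp hk).const_mul 2)
    simp only [mul_zero, add_zero] at this
    refine this.congr fun p => ?_
    simp only [hscale, Function.comp_apply]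
    ring
  have hlt : Real.exp (-1) < Real.exp (-l) := by
    have : 0 < 1 / ((B : ℝ) + 2) := by positivity
    exact Real.exp_lt_exp.2 (by linarith)
  have hev := (h1.add h3).eventually_lt h2 (by simpa using hlt)
  refine hB (hev.mono fun p hp hBp => ?_)
  simp only [Function.comp_apply] at hp
  rw [poissonCount_eq zero_le_one, poissonCount_eq hl.le, one_mul, ← hscale, Nat.floor_natCast]
    at hp
  refine absurd hp (not_lt.2 ?_)
  have h4 := wordRatio_zero_le_splice hb y g h (k := (p + 2) ^ 2) (by positivity) p
  refine le_trans ?_ (hscale p ▸ h4)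
  have h5 : copyStart b h p ≤ ⌊l * (scale b p : ℝ)⌋₊ + 1 := by
    have h6 : scale b p / (B + 2) ≤ scale b p / (h p + 2) :=
      Nat.div_le_div_left (by omega) (by omega)
    have h7 : (copyStart b h p : ℝ) < l * scale b p + 1 := by
      have h8 : copyStart b h p + scale b p / (B + 2) ≤ scale b p := by
        have : scale b p / (h p + 2) ≤ scale b p := Nat.div_le_self _ _
        unfold copyStart
        omega
      have h9 : (copyStart b h p : ℝ) + (scale b p / (B + 2) : ℕ) ≤ scale b p := by
        exact_mod_cast h8
      have h10 : (scale b p : ℝ) / ((B : ℝ) + 2) < (scale b p / (B + 2) : ℕ) + 1 := by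
        have := Nat.lt_succ_floor ((scale b p : ℝ) / ((B + 2 : ℕ) : ℝ))
        rw [Nat.floor_div_natCast, Nat.floor_natCast] at this
        push_cast at this
        exact this
      rw [hldef, sub_mul, one_mul, one_div_mul_eq_div]
      linarith
    by_contra! hcon
    have h11 : ⌊l * (scale b p : ℝ)⌋₊ + 1 + 1 ≤ copyStart b h p := hcon
    have h12 : ((⌊l * (scale b p : ℝ)⌋₊ : ℕ) : ℝ) + 1 + 1 ≤ copyStart b h p := by
      exact_mod_cast h11
    have := Nat.lt_floor_add_one (l * (scale b p : ℝ))
    linarith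
  simpa only [Finset.sum_range_one] using sum_wordRatio_anti y ((p + 2) ^ 2) 1 h5

end Splice

/-! ### Normality of spliced sequences -/

section SpliceNormal

variable {b : ℕ}

theorem abs_ite_sub_ite_le (p q : Prop) [Decidable p] [Decidable q] :
    |(if p then (1 : ℝ) else 0) - if q then 1 else 0| ≤ 1 := by
  split_ifs <;> simp

/-- Occurrences split into those before `s`, those of the prefix read a second time, and those after
`e`. Only windows straddling `s` or `e` are miscounted, at most `k` at each end. -/
theorem abs_startCount_copyPrefix_sub_le (y : ℕ → Fin b) {k : ℕ} (w : Fin k → Fin b) {s e : ℕ}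
    (hse : s ≤ e) (n : ℕ) :
    |(startCount (copyPrefix y s e) w n : ℝ) - (startCount y w (min s n) +
      startCount y w (min e n - min s n) + (startCount y w n - startCount y w (min e n)))| ≤
        2 * k := by
  let bad : Finset ℕ := Finset.Ico (s - k) s ∪ Finset.Ico (e - k) e
  let D : ℕ → ℝ := fun n => (startCount (copyPrefix y s e) w n : ℝ) - (startCount y w (min s n) +
      startCount y w (min e n - min s n) + (startCount y w n - startCount y w (min e n)))
  have hstep : ∀ n, |D (n + 1) - D n| ≤ if n ∈ bad then 1 else 0 := by
    intro n
    -- Here `m` is the position in `y` whose digits are read at `n`.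
    obtain ⟨m, hDm, hwin⟩ : ∃ m, D (n + 1) - D n =
        (if window (copyPrefix y s e) k n = w then 1 else 0) - (if window y k m = w then 1 else 0) ∧
        (n ∉ bad → window (copyPrefix y s e) k n = window y k m) := by
      simp only [bad, Finset.mem_union, Finset.mem_Ico]
      rcases lt_or_ge n s with h1 | h1
      · refine ⟨n, ?_, fun hn => window_congr fun t ht => by rw [copyPrefix, if_neg (by omega)]⟩
        simp only [D]
        rw [min_eq_right (by omega), min_eq_right (by omega), min_eq_right (by omega),
          min_eq_right (by omega), startCount_succ, startCount_succ]
        push_cast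
        simp only [Nat.sub_self]
        ring
      · rcases lt_or_ge n e with h2 | h2
        · refine ⟨n - s, ?_, fun hn => window_congr fun t ht => by
            rw [copyPrefix, if_pos (by omega)]; congr 1; omega⟩
          simp only [D]
          rw [show min s (n + 1) = s by omega, show min s n = s by omega,
            show min e (n + 1) = n + 1 by omega, show min e n = n by omega, startCount_succ,
            Nat.sub_add_comm h1, startCount_succ y w (n - s)]
          push_cast
          ring
        · refine ⟨n, ?_, fun hn => window_congr fun t ht => by rw [copyPrefix, if_neg (by omega)]⟩
          simp only [D]
          rw [min_eq_left (by omega), min_eq_left (by omega), min_eq_left (by omega),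
            min_eq_left (by omega), startCount_succ, startCount_succ]
          push_cast
          ring
    rw [hDm]
    by_cases hb : n ∈ bad
    · rw [if_pos hb]
      exact abs_ite_sub_ite_le _ _
    · rw [if_neg hb, hwin hb, sub_self, abs_zero]
  have hsum : |D n| ≤ ∑ i ∈ Finset.range n, if i ∈ bad then (1 : ℝ) else 0 := by
    induction n with
    | zero => simp [D, startCount]
    | succ n ih =>
      rw [Finset.sum_range_succ]
      have h1 := abs_add_le (D n) (D (n + 1) - D n)
      rw [add_sub_cancel] at h1
      exact h1.trans (add_le_add ih (hstep n))
  refine hsum.trans ?_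
  rw [← Finset.sum_filter, Finset.sum_const, nsmul_eq_mul, mul_one]
  have h1 : ((Finset.range n).filter fun i => i ∈ bad).card ≤ bad.card :=
    Finset.card_le_card fun i hi => (Finset.mem_filter.1 hi).2
  have h2 := Finset.card_union_le (Finset.Ico (s - k) s) (Finset.Ico (e - k) e)
  rw [Nat.card_Ico, Nat.card_Ico] at h2
  have h3 : ((Finset.range n).filter fun i => i ∈ bad).card ≤ 2 * k := by
    refine h1.trans (h2.trans ?_)
    omega
  exact_mod_cast h3

theorem isNormalSeq_iff_countDeviation {d : ℕ → Fin b} :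
    IsNormalSeq d ↔ ∀ (k : ℕ) (w : Fin k → Fin b), ∀ ε > 0,
      ∀ᶠ n in atTop, |countDeviation d w n| ≤ ε * n := by
  rw [isNormalSeq_iff]
  refine forall₂_congr fun k w => ?_
  have key : ∀ n : ℕ, 0 < n → |(startCount d w n : ℝ) / n - 1 / (b : ℝ) ^ k| =
      |countDeviation d w n| / n := by
    intro n hn
    have hn' : (0 : ℝ) < n := by exact_mod_cast hn
    rw [countDeviation, eq_div_iff hn'.ne', ← abs_of_pos hn', ← abs_mul, abs_of_pos hn', sub_mul,
      div_mul_cancel₀ _ hn'.ne', mul_comm (n : ℝ)]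
  rw [Metric.tendsto_nhds]
  constructor
  · intro h ε hε
    filter_upwards [h ε hε, eventually_gt_atTop 0] with n hn h0
    have h0' : (0 : ℝ) < n := by exact_mod_cast h0
    rw [Real.dist_eq, key n h0, div_lt_iff₀ h0'] at hn
    exact hn.le
  · intro h ε hε
    filter_upwards [h (ε / 2) (by positivity), eventually_gt_atTop 0] with n hn h0
    have h0' : (0 : ℝ) < n := by exact_mod_cast h0
    rw [Real.dist_eq, key n h0, div_lt_iff₀ h0']
    nlinarith

variable [NeZero b]

/-- The pieces of a spliced sequence may be short; for short ones the deviation is at most their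
length, which is small compared with `n`. -/
theorem IsNormalSeq.eventually_forall_le {y : ℕ → Fin b} (hy : IsNormalSeq y) {k : ℕ}
    (w : Fin k → Fin b) {ε : ℝ} (hε : 0 < ε) :
    ∀ᶠ n : ℕ in atTop, ∀ a ≤ n, |countDeviation y w a| ≤ ε * n := by
  obtain ⟨A, hA⟩ := eventually_atTop.1 (isNormalSeq_iff_countDeviation.1 hy k w ε hε)
  have h1 : ∀ᶠ n : ℕ in atTop, (A : ℝ) ≤ ε * n :=
    (tendsto_natCast_atTop_atTop.const_mul_atTop hε).eventually_ge_atTop _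
  filter_upwards [h1] with n hn a han
  rcases le_total A a with h | h
  · exact (hA a h).trans (mul_le_mul_of_nonneg_left (Nat.cast_le.2 han) hε.le)
  · have h2 := abs_countDeviation_sub_le y w (Nat.zero_le a)
    have h3 : countDeviation y w 0 = 0 := by simp [countDeviation, startCount]
    rw [h3, sub_zero, Nat.cast_zero, sub_zero] at h2
    exact h2.trans ((Nat.cast_le.2 h).trans hn)

/-- The comparison is with `copyPrefix`, not with `y`, so `h` is arbitrary: counts in `copyPrefix`
combine four counts in `y` whose expectations add up to the right one. -/
theorem isNormalSeq_splice (hb : 2 ≤ b) {y : ℕ → Fin b} (hy : IsNormalSeq y) {g : ℕ → ℕ}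
    (h : ℕ → ℕ) (hg : Tendsto g atTop atTop) : IsNormalSeq (splice y g h) := by
  refine isNormalSeq_iff_countDeviation.2 fun k w ε hε => ?_
  obtain ⟨r, hr, hrM⟩ := exists_scale_index hb
  let u : ℕ → ℝ := fun p => (scaleStart b p : ℝ) / scale b p + 1 / ((g p : ℝ) + 2)
  have hu0 : ∀ p, 0 ≤ u p := fun p => by positivity
  have hu : Tendsto u atTop (𝓝 0) := by
    simpa [u] using (tendsto_scaleStart_div_scale hb).add (tendsto_one_div_add_two hg)
  have hM : Tendsto (fun n => n + k) atTop atTop := tendsto_add_atTop_nat k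
  -- The budget is four deviations of `ε / 16 * n`, altered windows `ε / 4 * n + 2 * k + (k + 2)`,
  -- and boundary errors `2 * k`.
  have hconst : ∀ᶠ n : ℕ in atTop, (5 * k + 2 : ℝ) ≤ ε / 4 * n :=
    (tendsto_natCast_atTop_atTop.const_mul_atTop (by positivity)).eventually_ge_atTop _
  filter_upwards [hM.eventually hrM, hy.eventually_forall_le w (ε := ε / 16) (by positivity),
    ((hu.comp hr).comp hM).eventually (ge_mem_nhds (show (0 : ℝ) < min 1 (ε / 8) by positivity)),
    hconst]
    with n hk hdev hun hcn
  set p := r (n + k)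
  have hup : u p ≤ min 1 (ε / 8) := hun
  have hN : (0 : ℝ) < scale b p := by
    have := sixteen_le_scale hb p
    exact_mod_cast (by omega : 0 < scale b p)
  have h1 := card_windowDiff_copyPrefix_le hb y g h hk.2
  have h2 : ((windowDiff (splice y g h)
      (copyPrefix y (copyStart b h p) (scale b p)) k n).card : ℝ) ≤
      u p * scale b p + (k + 2) := by
    have h3 : ((windowDiff (splice y g h)
        (copyPrefix y (copyStart b h p) (scale b p)) k n).card : ℝ) ≤ scaleStart b p +
        ((scale b p / (g p + 2) : ℕ) : ℝ) + (k + 2) := by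
      exact_mod_cast h1
    have h5 := cast_div_le (scale b p) (g p)
    have h6 : (scaleStart b p : ℝ) / scale b p * scale b p = scaleStart b p :=
      div_mul_cancel₀ _ hN.ne'
    simp only [u, add_mul, h6]
    linarith
  have h3 : (scale b p : ℝ) ≤ 2 * ((n : ℝ) + k) := by exact_mod_cast hk.1
  have h4 : u p * scale b p ≤ ε / 4 * n + 2 * k := by
    have h5 := mul_le_mul_of_nonneg_left h3 (hu0 p)
    have h6 := mul_le_mul_of_nonneg_right (hup.trans (min_le_right _ _))
      (by positivity : (0 : ℝ) ≤ 2 * n)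
    have h7 := mul_le_mul_of_nonneg_right (hup.trans (min_le_left _ _))
      (by positivity : (0 : ℝ) ≤ 2 * k)
    linarith
  have h5 := (abs_startCount_sub_le_windowDiff (splice y g h)
    (copyPrefix y (copyStart b h p) (scale b p)) w n).trans h2
  have h6 := abs_startCount_copyPrefix_sub_le y w (copyStart_le (b := b) h p) n
  set s := copyStart b h p
  set e := scale b p
  have hmin : min s n ≤ min e n := min_le_min_right n (copyStart_le (b := b) h p)
  have h7 := hdev (min s n) (min_le_right _ _)
  have h8 := hdev (min e n - min s n) ((Nat.sub_le _ _).trans (min_le_right _ _))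
  have h9 := hdev n le_rfl
  have h10 := hdev (min e n) (min_le_right _ _)
  simp only [countDeviation] at h7 h8 h9 h10 ⊢
  rw [Nat.cast_sub hmin] at h8
  rw [abs_le] at h5 h6 h7 h8 h9 h10 ⊢
  constructor <;> linarith

/-- Whenever `g p < B`, the run of zeros has length at least a fixed fraction of the scale. Over it
the deviation of the letter zero rises by at least half its length, too much for both ends to have
small deviation. -/
theorem not_isNormalSeq_splice (hb : 2 ≤ b) (y : ℕ → Fin b) {g : ℕ → ℕ} (h : ℕ → ℕ)
    (hg : ¬Tendsto g atTop atTop) : ¬IsNormalSeq (splice y g h) := by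
  intro hd
  simp only [tendsto_atTop, not_forall, not_eventually, not_le] at hg
  obtain ⟨B, hB⟩ := hg
  let w : Fin 1 → Fin b := fun _ => 0
  -- With this `ε` and scale `N`, the run has length at least `16 * ε * N`, so the deviation rises
  -- by `8 * ε * N`, while normality allows `4 * ε * N`.
  have hε : (0 : ℝ) < 1 / (32 * (B + 2)) := by positivity
  have hsc : Tendsto (scale b) atTop atTop := (strictMono_scale hb).tendsto_atTop
  have hev := isNormalSeq_iff_countDeviation.1 hd 1 w _ hε
  have hev1 := ((tendsto_add_atTop_nat 1).comp hsc).eventually hev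
  have hT : Tendsto (fun p => scale b p + 1 + scale b p / (B + 2)) atTop atTop :=
    tendsto_atTop_mono (fun p => by rw [add_assoc]; exact Nat.le_add_right _ _) hsc
  have hev2 := hT.eventually hev
  refine hB ?_
  filter_upwards [hev1, hev2, hsc.eventually_ge_atTop (2 * (B + 2))] with p h1 h2 h3 hBp
  simp only [Function.comp_apply] at h1
  have hcount : ∀ m, m ≤ scale b p / (B + 2) → startCount (splice y g h) w (scale b p + 1 + m) =
      startCount (splice y g h) w (scale b p + 1) + m := by
    intro m
    induction m with
    | zero => simp
    | succ m ih =>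
      intro hm
      have h6 : scale b p / (B + 2) ≤ scale b p / (g p + 2) :=
        Nat.div_le_div_left (by omega) (by omega)
      have : splice y g h (scale b p + 1 + m) = 0 :=
        splice_pad hb y g h (p := p) (by omega) (by unfold padEnd; omega)
      rw [← add_assoc, startCount_succ, ih (by omega), if_pos, add_assoc]
      ext t
      simp [window, this, w]
  have h4 := hcount _ le_rfl
  have h4' : (startCount (splice y g h) w (scale b p + 1 + scale b p / (B + 2)) : ℝ) =
      startCount (splice y g h) w (scale b p + 1) + (scale b p / (B + 2) : ℕ) := by
    exact_mod_cast h4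
  simp only [countDeviation] at h1 h2
  rw [h4'] at h2
  have hL1 : (scale b p / (B + 2) : ℕ) + (1 : ℝ) ≤ scale b p := by
    have : scale b p / (B + 2) ≤ scale b p / 2 := Nat.div_le_div_left (by omega) (by omega)
    have := sixteen_le_scale hb p
    exact_mod_cast (by omega : scale b p / (B + 2) + 1 ≤ scale b p)
  have hL2 : (scale b p : ℝ) / (2 * (B + 2)) ≤ (scale b p / (B + 2) : ℕ) := by
    have h5 := Nat.lt_succ_floor ((scale b p : ℝ) / ((B + 2 : ℕ) : ℝ))
    rw [Nat.floor_div_natCast, Nat.floor_natCast] at h5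
    push_cast at h5
    have h6 : (2 * (B + 2) : ℝ) ≤ scale b p := by exact_mod_cast h3
    have h7 : 1 ≤ (scale b p : ℝ) / (2 * (B + 2)) := (one_le_div (by positivity)).2 h6
    have h8 : (scale b p : ℝ) / (B + 2) = 2 * ((scale b p : ℝ) / (2 * (B + 2))) := by
      field_simp
    linarith
  have hq : 1 / (b : ℝ) ^ 1 ≤ 1 / 2 := by
    have : (2 : ℝ) ≤ b := by exact_mod_cast hb
    rw [pow_one]
    exact one_div_le_one_div_of_le (by norm_num) this
  have hscale : (16 : ℝ) ≤ scale b p := by exact_mod_cast sixteen_le_scale hb p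
  have hεN : (scale b p : ℝ) / (2 * (B + 2)) = 16 * (1 / (32 * (B + 2)) * scale b p) := by
    field_simp
    norm_num
  push_cast at h1 h2 hL1 hL2
  set L : ℝ := ((scale b p / (B + 2) : ℕ) : ℝ)
  set N : ℝ := (scale b p : ℝ)
  set ε : ℝ := 1 / (32 * ((B : ℝ) + 2))
  set q : ℝ := 1 / (b : ℝ) ^ 1
  have hL0 : 0 ≤ L := by positivity
  have h9 := mul_le_mul_of_nonneg_left hq hL0
  have h10 : ε * (N + 1 + L) ≤ ε * (2 * N) := mul_le_mul_of_nonneg_left (by linarith) hε.le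
  have h11 : ε * (N + 1) ≤ ε * (2 * N) := mul_le_mul_of_nonneg_left (by linarith) hε.le
  have h12 : 0 < ε * N := by positivity
  rw [abs_le] at h1 h2
  linarith [h1.1, h1.2, h2.1, h2.2]

end SpliceNormal

/-! ### Completeness -/

theorem isD2Pi03Hard_Ico (b : ℕ) (hb : 2 ≤ b) :
    IsD2Pi03Hard.{u, 0}
      {x : Set.Ico (0 : ℝ) 1 | (x : ℝ) ∈ normalNumbers b \ poissonGenericNumbers b} := by
  intro X _ _ hX B hB
  have : NeZero b := ⟨by omega⟩
  obtain ⟨C, D, hC, hD, rfl⟩ := hB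
  obtain ⟨g, hg, hCg⟩ := hC.three_exists_tendsto_atTop hX
  obtain ⟨h, hh, hDh⟩ := hD.three_exists_tendsto_atTop hX
  obtain ⟨y, hyN, hyP⟩ := exists_isNormalSeq_and_isPoissonGenericSeq hb
  let d : X → ℕ → Fin b := fun x => splice y (g x) (h x)
  have hd : Continuous d :=
    continuous_pi fun j => (isLocallyConstant_splice y hg hh j).continuous
  have hexp := fun x => isExpansion_splice hb y (g x) (h x)
  refine ⟨fun x => ⟨Real.ofDigits (d x), Real.ofDigits_nonneg _, (hexp x).1⟩,
    (Real.continuous_ofDigits.comp hd).subtype_mk _, ?_⟩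
  ext x
  simp only [Set.mem_preimage, Set.mem_ofPred_eq, Set.mem_sdiff]
  rw [(hexp x).2.mem_normalNumbers_iff, (hexp x).2.mem_poissonGenericNumbers_iff, hCg, hDh]
  -- If `g x` does not diverge, both sides fail whatever `h x` does; otherwise normality is granted
  -- and `h x` decides Poisson genericity.
  by_cases hgx : Tendsto (g x) atTop atTop
  · refine and_congr (iff_of_true (isNormalSeq_splice hb hyN (h x) hgx) hgx) (not_congr ?_)
    refine ⟨fun hP => ?_, isPoissonGenericSeq_splice hb hyP hgx⟩
    by_contra hhx
    exact not_isPoissonGenericSeq_splice hb hyP hhx hP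
  · exact iff_of_false (fun H => not_isNormalSeq_splice hb y (h x) hgx H.1) fun H => hgx H.1

theorem IsD2Pi03Hard.of_preimage_val {s : Set ℝ} {A : Set ℝ}
    (hA : IsD2Pi03Hard.{u, 0} {x : s | (x : ℝ) ∈ A}) : IsD2Pi03Hard.{u, 0} A := by
  intro X _ _ hX B hB
  obtain ⟨f, hf, rfl⟩ := hA X hX B hB
  exact ⟨fun x => f x, continuous_subtype_val.comp hf, rfl⟩

theorem theorem2 (b : ℕ) (hb : 2 ≤ b) :
    IsD2Pi03Complete.{u, 0}
        {x : Set.Ico (0 : ℝ) 1 | (x : ℝ) ∈ normalNumbers b \ poissonGenericNumbers b} ∧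
      IsD2Pi03Complete.{u, 0} (normalNumbers b \ poissonGenericNumbers b) :=
  ⟨⟨(isD2Pi03_normal_diff_poissonGeneric hb).preimage continuous_subtype_val,
      isD2Pi03Hard_Ico b hb⟩,
    isD2Pi03_normal_diff_poissonGeneric hb, (isD2Pi03Hard_Ico b hb).of_preimage_val⟩
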